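/- Let $\mathbf A$ be the Clifford algebra over $\mathbb C$ generated by $\psi_m,\psi_m^*$ ($m\in\mathbb Z$) with $\psi_m\psi_n+\psi_n\psi_m=\psi^*_m\psi^*_n+\psi^*_n\psi^*_m=0$ and $\psi_m\psi^*_n+\psi^*_n\psi_m=\delta_{mn}$. Let $F=\mathbf A/\mathbf A W_{an}$ be the Fock space, where $W_{an}$ is spanned by $\psi_m$ $(m<0)$ and $\psi_m^*$ $(m\ge 0)$, with vacuum vector $|0\rangle=1 \bmod \mathbf A W_{an}$, and let $a\mapsto\langle 0|a|0\rangle$ be the vacuum expectation value on $\mathbf A$, given by $\langle 0|1|0\rangle=1$, the pair expectations $\langle 0|\psi_m\psi_m^*|0\rangle=1$ $(m<0)$, $\langle 0|\psi_m^*\psi_m|0\rangle=1$ $(m\ge 0)$, all other pairs of generators having expectation $0$, and the Wick rule. For $n\in\mathbb Z$ put $|n\rangle=\Psi_n|0\rangle$ and $\langle n|=\langle 0|\Psi_n^*$, where $\Psi_0=\Psi_0^*=1$, $\Psi_n=\psi_{n-1}\cdots\psi_1\psi_0$, $\Psi_n^*=\psi_0^*\psi_1^*\cdots\psi_{n-1}^*$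 for $n>0$, and $\Psi_n=\psi_n^*\cdots\psi_{-2}^*\psi_{-1}^*$, $\Psi^*_n=\psi_{-1}\psi_{-2}\cdots\psi_n$ for $n<0$. On $F$ consider the operators $$H_k=\sum_{i\in\mathbb Z}\psi_i\psi^*_{i+k}\ (k\ne 0),\qquad A_k=\sum_{i\in\mathbb Z}r(i)r(i-1)\cdots r(i-k+1)\,\psi^*_{i-k}\psi_i\ (k\ge 1),$$ where $r:\mathbb Z\to\mathbb C$ is an arbitrary function (only finitely many terms act nontrivially on a given vector), and put $\mathbf H=(H_1,\tfrac{H_2}2,\tfrac{H_3}3,\dots)$, $\mathbf H^*=(H_{-1},\tfrac{H_{-2}}2,\tfrac{H_{-3}}3,\dots)$, $\mathbf A_r=(A_1,\tfrac{A_2}2,\tfrac{A_3}3,\dots)$. Let $\Lambda=\mathbb C[\gamma_1,\gamma_2,\dots]$ be the space of symmetric functions, $\gamma_m=\frac1m p_m$ with $p_m$ the power sums. Define $h_k\in\Lambda$ by $\sum_{k\ge0}h_kz^k=\exp\sum_{m\ge1}\gamma_mz^m$ ($h_k=0$ for $k<0$), and for a partition $\lambda$ of length $\ell(\lambda)$ the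 Schur function $s_\lambda=\det(h_{\lambda_i-i+j})_{1\le i,j\le \ell(\lambda)}$ and $r_\lambda(n)=\prod_{(i,j)\in\lambda}r(n+j-i)$, the product being over the nodes (row $i$, column $j$) of the Young diagram of $\lambda$. For $f\in\Lambda$ and a sequence $X=(X_1,X_2,\dots)$ of commuting operators, $f(X)$ denotes the result of substituting $X_m$ for $\gamma_m$. Then the components of $\mathbf H$ commute with each other, as do those of $\mathbf H^*$ and those of $\mathbf A_r$ for every $r$, and: (1) For the scalar product $\langle f,g\rangle=\big(f(\partial_{\gamma_1},\tfrac12\partial_{\gamma_2},\tfrac13\partial_{\gamma_3},\dots)\,g\big)\big|_{\gamma=0}$ one has $\langle f,g\rangle=\langle 0|f(\mathbf H)g(\mathbf H^*)|0\rangle$ for all $f,g\in\Lambda$. (2) For every $r:\mathbb Z\to\mathbb C$ and $n\in\mathbb Z$ there is exactly one bilinear form $\langle\cdot,\cdot\rangle_{r,n}$ on $\Lambda$ with $\langle s_\mu,s_\lambda\rangle_{r,n}=r_\lambda(n)\,\delta_{\mu\lambda}$ for all partitions $\mu,\lambda$, and $$\langle f,g\rangle_{r,n}=\langle n|f(\mathbf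 H)\,g(-\mathbf A_r)|n\rangle\qquad\text{for all } f,g\in\Lambda .$$ -/

import Mathlib

noncomputable section

namespace FreeFermion

/-! ### Free fermions: the Clifford algebra -/

/-- The space `W = (⨁ ℂ ψ_m) ⊕ (⨁ ℂ ψ*_m)` of free fermions: the pair `(f, g)` stands for
`∑ f m ψ_m + ∑ g m ψ*_m`. -/
abbrev W : Type := (ℤ →₀ ℂ) × (ℤ →₀ ℂ)

/-- The bilinear form `(f, g) ↦ ∑ m, c m * f m * g m` on finitely supported sequences. -/
def wpair (c : ℤ → ℂ) : (ℤ →₀ ℂ) →ₗ[ℂ] (ℤ →₀ ℂ) →ₗ[ℂ] ℂ :=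
  Finsupp.lsum ℂ fun m =>
    LinearMap.toSpanSingleton ℂ ((ℤ →₀ ℂ) →ₗ[ℂ] ℂ) (c m • Finsupp.lapply m)

theorem wpair_single_single (c : ℤ → ℂ) (m n : ℤ) (a b : ℂ) :
    wpair c (Finsupp.single m a) (Finsupp.single n b) = if m = n then c m * a * b else 0 := by
  by_cases h : m = n
  · subst h
    simp [wpair]
    ring
  · simp [wpair, h]

theorem wpair_add (c d : ℤ → ℂ) : wpair c + wpair d = wpair (c + d) := by
  ext m n
  simp only [LinearMap.comp_apply, LinearMap.add_apply, Finsupp.lsingle_apply,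
    wpair_single_single, Pi.add_apply]
  split_ifs <;> ring

theorem wpair_symm (c : ℤ → ℂ) (f g : ℤ →₀ ℂ) : wpair c f g = wpair c g f := by
  have : wpair c = (wpair c).flip := by
    ext m n
    simp only [LinearMap.comp_apply, LinearMap.flip_apply, Finsupp.lsingle_apply,
      wpair_single_single]
    by_cases h : m = n
    · subst h; simp
    · simp [h, Ne.symm h]
  conv_lhs => rw [this]
  rfl

/-- The quadratic form `Q (f, g) = ∑ m, f m * g m`; its Clifford algebra has the canonical
anticommutation relations as defining relations. -/
def Q : QuadraticForm ℂ W :=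
  LinearMap.BilinMap.toQuadraticMap
    (((wpair fun _ => 1).compl₂ (LinearMap.snd ℂ (ℤ →₀ ℂ) (ℤ →₀ ℂ))).comp
      (LinearMap.fst ℂ (ℤ →₀ ℂ) (ℤ →₀ ℂ)))

/-- The algebra of free fermions. -/
abbrev A : Type := CliffordAlgebra Q

/-- The fermion `ψ_m`. -/
def ψ (m : ℤ) : A := CliffordAlgebra.ι Q (Finsupp.single m 1, 0)

/-- The fermion `ψ*_m`. -/
def ψs (m : ℤ) : A := CliffordAlgebra.ι Q (0, Finsupp.single m 1)

theorem Q_apply (w : W) : Q w = wpair (fun _ => 1) w.1 w.2 := rfl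

theorem ι_anticomm (v w : W) :
    CliffordAlgebra.ι Q v * CliffordAlgebra.ι Q w + CliffordAlgebra.ι Q w * CliffordAlgebra.ι Q v
      = algebraMap ℂ A (wpair (fun _ => 1) v.1 w.2 + wpair (fun _ => 1) w.1 v.2) := by
  rw [CliffordAlgebra.ι_mul_ι_add_swap]
  congr 1
  simp only [QuadraticMap.polar, Q_apply, Prod.fst_add, Prod.snd_add, map_add,
    LinearMap.add_apply]
  ring

theorem ψ_anticomm (m n : ℤ) : ψ m * ψ n + ψ n * ψ m = 0 := by
  simp [ψ, ι_anticomm]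

theorem ψs_anticomm (m n : ℤ) : ψs m * ψs n + ψs n * ψs m = 0 := by
  simp [ψs, ι_anticomm]

theorem ψ_ψs_anticomm (m n : ℤ) : ψ m * ψs n + ψs n * ψ m = if m = n then 1 else 0 := by
  rw [ψ, ψs, ι_anticomm]
  simp only [wpair_single_single]
  split_ifs <;> simp

/-! ### The vacuum expectation value -/

/-- The pair expectations `⟨0| v w |0⟩` of `v, w ∈ W`:
`⟨0|ψ_m ψ*_m|0⟩ = 1` for `m < 0`, `⟨0|ψ*_m ψ_m|0⟩ = 1` for `m ≥ 0`,
and all other pairs of generators have expectation `0`. -/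
def twoPoint : LinearMap.BilinForm ℂ W :=
  ((wpair fun m => if m < 0 then 1 else 0).compl₂ (LinearMap.snd ℂ (ℤ →₀ ℂ) (ℤ →₀ ℂ))).comp
      (LinearMap.fst ℂ (ℤ →₀ ℂ) (ℤ →₀ ℂ)) +
  ((wpair fun m => if m < 0 then 0 else 1).compl₂ (LinearMap.fst ℂ (ℤ →₀ ℂ) (ℤ →₀ ℂ))).comp
      (LinearMap.snd ℂ (ℤ →₀ ℂ) (ℤ →₀ ℂ))

theorem twoPoint_apply (v w : W) :
    twoPoint v w = wpair (fun m => if m < 0 then 1 else 0) v.1 w.2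
      + wpair (fun m => if m < 0 then 0 else 1) v.2 w.1 := rfl

theorem twoPoint_toQuadraticMap :
    (-twoPoint).toQuadraticMap = (0 : QuadraticForm ℂ W) - Q := by
  ext w
  have h := congrArg (fun b => b w.1 w.2)
    (wpair_add (fun m => if m < 0 then 1 else 0) (fun m => if m < 0 then 0 else 1))
  have h2 : ((fun m : ℤ => if m < 0 then (1 : ℂ) else 0) + fun m : ℤ => if m < 0 then 0 else 1)
      = fun _ => 1 := by
    funext m
    by_cases hm : m < 0 <;> simp [hm]
  rw [h2] at h
  simp only [LinearMap.add_apply] at h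
  simp only [LinearMap.BilinMap.toQuadraticMap_apply, LinearMap.neg_apply, twoPoint_apply,
    _root_.sub_apply, _root_.zero_apply, Q_apply, ← h]
  rw [wpair_symm _ w.2 w.1]
  ring

/-- Normal ordering: the linear isomorphism from the Clifford algebra to the exterior algebra that
replaces a product of fermions by the sum over all partial contractions by `twoPoint`. -/
def normalOrder : A →ₗ[ℂ] ExteriorAlgebra ℂ W :=
  CliffordAlgebra.changeForm twoPoint_toQuadraticMap

/-- The vacuum expectation value `a ↦ ⟨0| a |0⟩`: the fully contracted part of `a`, as prescribed
by the Wick rule. -/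
def vev : A →ₗ[ℂ] ℂ := ExteriorAlgebra.algebraMapInv.toLinearMap ∘ₗ normalOrder

theorem vev_one : vev 1 = 1 := by
  simp [vev, normalOrder, CliffordAlgebra.changeForm_one]

theorem normalOrder_ι_mul (w : W) (a : A) :
    normalOrder (CliffordAlgebra.ι Q w * a) =
      ExteriorAlgebra.ι ℂ w * normalOrder a
        + CliffordAlgebra.contractLeft (twoPoint w) (normalOrder a) := by
  rw [normalOrder, CliffordAlgebra.changeForm_ι_mul]
  simp [ExteriorAlgebra.ι]

theorem vev_ι_mul (w : W) (a : A) :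
    vev (CliffordAlgebra.ι Q w * a) = ExteriorAlgebra.algebraMapInv
      (CliffordAlgebra.contractLeft (twoPoint w) (normalOrder a) : ExteriorAlgebra ℂ W) := by
  simp [vev, normalOrder_ι_mul, ExteriorAlgebra.algebraMapInv]

/-- Expectation values of pairs. -/
theorem vev_ι_mul_ι (v w : W) :
    vev (CliffordAlgebra.ι Q v * CliffordAlgebra.ι Q w) = twoPoint v w := by
  rw [vev_ι_mul, normalOrder, CliffordAlgebra.changeForm_ι, CliffordAlgebra.contractLeft_ι]
  exact ExteriorAlgebra.algebraMap_leftInverse W _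

/-- Fermions `w` with `⟨0|w = 0`. -/
theorem vev_ι_mul_eq_zero {w : W} (hw : twoPoint w = 0) (a : A) :
    vev (CliffordAlgebra.ι Q w * a) = 0 := by
  simp [vev_ι_mul, hw]

theorem contractLeft_mul_ι_of_eq_zero {d : Module.Dual ℂ W} {w : W} (hd : d w = 0)
    (x : ExteriorAlgebra ℂ W) :
    CliffordAlgebra.contractLeft d (x * ExteriorAlgebra.ι ℂ w) =
      CliffordAlgebra.contractLeft d x * ExteriorAlgebra.ι ℂ w := by
  induction x using CliffordAlgebra.left_induction with
  | algebraMap c =>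
    rw [CliffordAlgebra.contractLeft_algebraMap_mul, CliffordAlgebra.contractLeft_algebraMap,
      ExteriorAlgebra.ι, CliffordAlgebra.contractLeft_ι, hd]
    simp
  | add x y hx hy => rw [add_mul, map_add, hx, hy, map_add, add_mul]
  | ι_mul x m hx =>
    rw [mul_assoc, CliffordAlgebra.contractLeft_ι_mul, hx, CliffordAlgebra.contractLeft_ι_mul,
      sub_mul, smul_mul_assoc, mul_assoc]

/-- Fermions `w` with `w|0⟩ = 0`. -/
theorem vev_mul_ι_eq_zero {w : W} (hw : ∀ v, twoPoint v w = 0) (a : A) :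
    vev (a * CliffordAlgebra.ι Q w) = 0 := by
  have key : normalOrder (a * CliffordAlgebra.ι Q w) =
      normalOrder a * ExteriorAlgebra.ι ℂ w := by
    induction a using CliffordAlgebra.left_induction with
    | algebraMap c =>
      rw [← Algebra.smul_def, map_smul, normalOrder, CliffordAlgebra.changeForm_ι,
        CliffordAlgebra.changeForm_algebraMap, Algebra.smul_def]
    | add x y hx hy => rw [add_mul, map_add, hx, hy, map_add, add_mul]
    | ι_mul x m hx =>
      rw [mul_assoc, normalOrder_ι_mul, hx, contractLeft_mul_ι_of_eq_zero (hw m),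
        normalOrder_ι_mul, add_mul, mul_assoc]
  simp [vev, key, ExteriorAlgebra.algebraMapInv]

/-! ### The Fock space -/

/-- The left ideal `A W_an`, where `W_an` is spanned by `ψ_m` (`m < 0`) and `ψ*_m` (`m ≥ 0`). -/
def annIdeal : Ideal A := Ideal.span ({a | ∃ m < 0, a = ψ m} ∪ {a | ∃ m, 0 ≤ m ∧ a = ψs m})

/-- The Fock space `F = A / A W_an`, a left `A`-module. -/
abbrev Fock : Type := A ⧸ annIdeal

/-- The right vacuum vector `|0⟩`. -/
def vac : Fock := Submodule.Quotient.mk 1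

theorem vev_eq_zero_of_mem {a : A} (ha : a ∈ annIdeal) : vev a = 0 := by
  suffices h : ∀ b : A, vev (b * a) = 0 by simpa using h 1
  refine Submodule.span_induction (p := fun a _ => ∀ b : A, vev (b * a) = 0)
    ?_ ?_ ?_ ?_ ha
  · rintro x (⟨m, hm, rfl⟩ | ⟨m, hm, rfl⟩) b
    · refine vev_mul_ι_eq_zero (fun v => ?_) b
      rw [twoPoint_apply, wpair_symm _ v.2]
      simp [wpair, hm]
    · refine vev_mul_ι_eq_zero (fun v => ?_) b
      rw [twoPoint_apply, wpair_symm _ v.1]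
      simp [wpair, not_lt.mpr hm]
  · simp
  · intro x y _ _ hx hy b
    rw [mul_add, map_add, hx, hy, add_zero]
  · intro c x _ hx b
    rw [smul_eq_mul, ← mul_assoc]
    exact hx _

/-- The left vacuum `⟨0|` as a functional on the Fock space: `a|0⟩ ↦ ⟨0|a|0⟩`. -/
def bra0 : Fock →ₗ[ℂ] ℂ :=
  Submodule.liftQ (annIdeal.restrictScalars ℂ) vev fun _ ha => vev_eq_zero_of_mem ha

theorem bra0_smul_vac (a : A) : bra0 (a • vac) = vev a := by
  have : a • vac = Submodule.Quotient.mk a := by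
    rw [vac, ← Submodule.Quotient.mk_smul, smul_eq_mul, mul_one]
  rw [this]
  rfl

theorem ψ_smul_vac {m : ℤ} (hm : m < 0) : ψ m • vac = 0 := by
  rw [vac, ← Submodule.Quotient.mk_smul, Submodule.Quotient.mk_eq_zero, smul_eq_mul, mul_one]
  exact Ideal.subset_span (Or.inl ⟨m, hm, rfl⟩)

theorem ψs_smul_vac {m : ℤ} (hm : 0 ≤ m) : ψs m • vac = 0 := by
  rw [vac, ← Submodule.Quotient.mk_smul, Submodule.Quotient.mk_eq_zero, smul_eq_mul, mul_one]
  exact Ideal.subset_span (Or.inr ⟨m, hm, rfl⟩)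

/-- `Ψ_N = ψ_{N-1} ⋯ ψ_1 ψ_0` for `N ≥ 0`. -/
def raiseKet : ℕ → A
  | 0 => 1
  | N + 1 => ψ N * raiseKet N

/-- `Ψ_{-N} = ψ*_{-N} ⋯ ψ*_{-2} ψ*_{-1}` for `N ≥ 0`. -/
def lowerKet : ℕ → A
  | 0 => 1
  | N + 1 => ψs (-(N + 1)) * lowerKet N

/-- `Ψ*_N = ψ*_0 ψ*_1 ⋯ ψ*_{N-1}` for `N ≥ 0`. -/
def raiseBra : ℕ → A
  | 0 => 1
  | N + 1 => raiseBra N * ψs N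

/-- `Ψ*_{-N} = ψ_{-1} ψ_{-2} ⋯ ψ_{-N}` for `N ≥ 0`. -/
def lowerBra : ℕ → A
  | 0 => 1
  | N + 1 => lowerBra N * ψ (-(N + 1))

/-- The vacuum vector `|n⟩ = Ψ_n |0⟩` of charge `n`. -/
def ket (n : ℤ) : Fock :=
  if 0 ≤ n then raiseKet n.toNat • vac else lowerKet (-n).toNat • vac

/-- The left vacuum `⟨n| = ⟨0| Ψ*_n`, as a functional on the Fock space. -/
def bra (n : ℤ) : Fock →ₗ[ℂ] ℂ :=
  bra0 ∘ₗ Algebra.lsmul ℂ ℂ Fock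
    (if 0 ≤ n then raiseBra n.toNat else lowerBra (-n).toNat)

/-! ### Infinite sums of fermions acting on the Fock space -/

/-- The operator `∑ i, X i` on the Fock space, for a family of elements of the Clifford algebra
only finitely many of which act nontrivially on any given vector. -/
def locSum (X : ℤ → A) (hX : ∀ v : Fock, {i | X i • v ≠ 0}.Finite) : Module.End ℂ Fock where
  toFun v := ∑ᶠ i, X i • v
  map_add' u v := by
    simp only [smul_add]
    exact finsum_add_distrib (hX u) (hX v)
  map_smul' c v := by
    simp only [RingHom.id_apply]
    rw [smul_finsum' c (hX v)]
    refine finsum_congr fun i => ?_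
    exact smul_comm _ _ _

theorem finite_ι_not_anticomm (w : W) :
    {m : ℤ | w.1 m ≠ 0 ∨ w.2 m ≠ 0}.Finite := by
  refine (w.1.support ∪ w.2.support).finite_toSet.subset fun m hm => ?_
  simpa using hm

theorem ψ_anticomm_ι {w : W} {m : ℤ} (h : w.2 m = 0) :
    ψ m * CliffordAlgebra.ι Q w = -(CliffordAlgebra.ι Q w * ψ m) := by
  rw [eq_neg_iff_add_eq_zero, ψ, ι_anticomm]
  simp [wpair, h]

theorem ψs_anticomm_ι {w : W} {m : ℤ} (h : w.1 m = 0) :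
    ψs m * CliffordAlgebra.ι Q w = -(CliffordAlgebra.ι Q w * ψs m) := by
  rw [eq_neg_iff_add_eq_zero, ψs, ι_anticomm]
  dsimp only
  rw [wpair_symm _ w.1]
  simp [wpair, h]

theorem ψ_ψs_comm_ι {w : W} {m n : ℤ} (hm : w.2 m = 0) (hn : w.1 n = 0) :
    ψ m * ψs n * CliffordAlgebra.ι Q w = CliffordAlgebra.ι Q w * (ψ m * ψs n) := by
  rw [mul_assoc, ψs_anticomm_ι hn, mul_neg, ← mul_assoc, ψ_anticomm_ι hm, neg_mul, neg_neg,
    mul_assoc]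

theorem ψ_mul_ψs_of_ne {m n : ℤ} (h : m ≠ n) : ψ m * ψs n = -(ψs n * ψ m) := by
  rw [eq_neg_iff_add_eq_zero, ψ_ψs_anticomm, if_neg h]

theorem finite_ψ_ψs {k : ℤ} (hk : k ≠ 0) (v : Fock) :
    {i : ℤ | (ψ i * ψs (i + k)) • v ≠ 0}.Finite := by
  obtain ⟨a, rfl⟩ := Submodule.Quotient.mk_surjective _ v
  have hmk : ∀ b : A, (Submodule.Quotient.mk b : Fock) = b • vac := fun b => by
    rw [vac, ← Submodule.Quotient.mk_smul, smul_eq_mul, mul_one]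
  rw [hmk]
  induction a using CliffordAlgebra.left_induction with
  | algebraMap c =>
    refine (Set.finite_Icc (-|k|) |k|).subset fun i hi => ?_
    rw [Set.mem_ofPred_eq, algebraMap_smul, smul_comm] at hi
    have hi' : (ψ i * ψs (i + k)) • vac ≠ 0 := fun h => hi (by rw [h, smul_zero])
    have h1 : i + k < 0 := by
      by_contra h
      exact hi' (by rw [mul_smul, ψs_smul_vac (not_lt.mp h), smul_zero])
    have h2 : 0 ≤ i := by
      by_contra h
      refine hi' ?_
      rw [ψ_mul_ψs_of_ne (by omega), neg_smul, mul_smul, ψ_smul_vac (not_le.mp h), smul_zero,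
        neg_zero]
    have := neg_abs_le k
    constructor <;> linarith [abs_nonneg k]
  | add x y hx hy =>
    refine (hx.union hy).subset fun i hi => ?_
    by_contra h
    simp only [Set.mem_union, Set.mem_ofPred_eq, not_or, not_not] at h
    exact hi (by rw [add_smul, smul_add, h.1, h.2, add_zero])
  | ι_mul x w hx =>
    have hw := finite_ι_not_anticomm w
    refine ((hx.union hw).union (hw.image fun i => i - k)).subset fun i hi => ?_
    by_contra h
    simp only [Set.mem_union, Set.mem_ofPred_eq, not_or, not_not, Set.mem_image, not_exists,
      not_and] at h
    obtain ⟨⟨h1, h2⟩, h3⟩ := h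
    have h4 : w.1 (i + k) = 0 := by
      by_contra h5
      exact h3 (i + k) (Or.inl h5) (by ring)
    refine hi ?_
    rw [smul_smul, ← mul_assoc, ψ_ψs_comm_ι h2.2 h4, mul_assoc, mul_smul, mul_smul, h1,
      smul_zero]

/-- The Heisenberg modes `H_k = ∑ i, ψ_i ψ*_{i+k}`, `k ≠ 0`. -/
def H (k : ℤ) (hk : k ≠ 0) : Module.End ℂ Fock :=
  locSum (fun i => ψ i * ψs (i + k)) (finite_ψ_ψs hk)

theorem finite_Amode (r : ℤ → ℂ) (k : ℕ+) (v : Fock) :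
    {i : ℤ | ((∏ j ∈ Finset.range k, r (i - j)) • (ψs (i - k) * ψ i)) • v ≠ 0}.Finite := by
  have hk : (-(k : ℤ)) ≠ 0 := by simp
  refine (finite_ψ_ψs hk v).subset fun i hi h => hi ?_
  have h' : (ψs (i - k) * ψ i) • v = 0 := by
    rw [ψ_mul_ψs_of_ne (by simp), ← sub_eq_add_neg, neg_smul, neg_eq_zero] at h
    exact h
  rw [smul_assoc, h', smul_zero]

/-- The modes `A_k = ∑ i, r(i) r(i-1) ⋯ r(i-k+1) ψ*_{i-k} ψ_i`, `k ≥ 1`. -/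
def Amode (r : ℤ → ℂ) (k : ℕ+) : Module.End ℂ Fock :=
  locSum (fun i => (∏ j ∈ Finset.range k, r (i - j)) • (ψs (i - k) * ψ i)) (finite_Amode r k)

/-! ### Symmetric functions -/

/-- Symmetric functions as polynomials in the variables `γ_m = p_m / m`, `m ≥ 1`, where `p_m` are
the power sums. -/
abbrev Sym : Type := MvPolynomial ℕ+ ℂ

/-- The complete symmetric functions `h_k(γ)`:
`∑ k, h_k(γ) z^k = exp (∑ m ≥ 1, γ_m z^m)`. -/
def h (k : ℕ) : Sym :=
  PowerSeries.coeff k ((PowerSeries.exp Sym).subst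
    (PowerSeries.mk fun m => if hm : 0 < m then MvPolynomial.X (m.toPNat hm) else 0))

/-- `h_k` for all integers `k`, with `h_k = 0` for `k < 0`. -/
def hInt (k : ℤ) : Sym := if 0 ≤ k then h k.toNat else 0

/-- The Schur function `s_lam(γ) = det (h_{lam_i - i + j}(γ))`, of size the length of `lam`. -/
def schur (lam : YoungDiagram) : Sym :=
  Matrix.det (Matrix.of fun i j : Fin (lam.colLen 0) =>
    hInt ((lam.rowLen i : ℤ) - (i : ℤ) + (j : ℤ)))

/-- `r_lam(n)`, the product of `r (n + j - i)` over the nodes `(i, j)` (row, column) of `lam`. -/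
def rProd (r : ℤ → ℂ) (lam : YoungDiagram) (n : ℤ) : ℂ :=
  ∏ c ∈ lam.cells, r (n + (c.2 : ℤ) - (c.1 : ℤ))

/-- The result `f(X)` of substituting operators `X_m` for `γ_m` in the polynomial `f`; in each
monomial the factors are multiplied in increasing order of `m`, which is immaterial for
commuting operators. -/
def evalOps {V : Type*} [AddCommGroup V] [Module ℂ V] (X : ℕ+ → Module.End ℂ V) (f : Sym) :
    Module.End ℂ V :=
  ∑ m ∈ f.support, f.coeff m • ((m.support.sort (· ≤ ·)).map fun k => X k ^ m k).prod

/-- `𝐇 = (H_1, H_2 / 2, …, H_m / m, …)`. -/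
def Hvec (m : ℕ+) : Module.End ℂ Fock := ((m : ℂ)⁻¹) • H (m : ℤ) (by simp)

/-- `𝐇* = (H_{-1}, H_{-2} / 2, …, H_{-m} / m, …)`. -/
def HstarVec (m : ℕ+) : Module.End ℂ Fock := ((m : ℂ)⁻¹) • H (-(m : ℤ)) (by simp)

/-- `𝐀 = (A_1, A_2 / 2, …, A_m / m, …)`. -/
def Avec (r : ℤ → ℂ) (m : ℕ+) : Module.End ℂ Fock := ((m : ℂ)⁻¹) • Amode r m

/-- The operators `(∂_{γ_1}, ∂_{γ_2} / 2, …, ∂_{γ_m} / m, …)` on symmetric functions. -/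
def derivVec (m : ℕ+) : Module.End ℂ Sym :=
  ((m : ℂ)⁻¹) • (MvPolynomial.pderiv m : Derivation ℂ Sym Sym).toLinearMap

/-- The undeformed scalar product `⟨f, g⟩`: apply `f(∂_{γ_1}, ∂_{γ_2} / 2, …)` to `g` and set
`γ = 0`. -/
def scalarProduct (f g : Sym) : ℂ := MvPolynomial.constantCoeff (evalOps derivVec f g)

/-- `B` is the deformed scalar product `⟨·, ·⟩_{r,n}`: the bilinear form with
`⟨s_mu, s_lam⟩_{r,n} = r_lam(n) δ_{mu,lam}`. -/
def IsDeformedScalarProduct (r : ℤ → ℂ) (n : ℤ) (B : LinearMap.BilinForm ℂ Sym) : Prop :=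
  (∀ lam : YoungDiagram, B (schur lam) (schur lam) = rProd r lam n) ∧
    ∀ mu lam : YoungDiagram, mu ≠ lam → B (schur mu) (schur lam) = 0

end FreeFermion

end

noncomputable section

namespace FreeFermion

/-! ### Charged vacua -/

/-! The heart is the formula `subA_schur_ket`: `s_λ(-A_r)|n⟩ = r_λ(n) |λ, n⟩`, where `|λ, n⟩`
(`basisKet`) is a wedge of fermions over a lower vacuum and does not depend on `r`. The dressed
fermions `str r j p = r(j+1)⋯r(j+p) ψ_{j+p}` satisfy `[-A_m/m, str_p] = (1/m) str_{p+m}`. Hence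
moving `str_p` to the right through the modes in `f(-A_r)` amounts to substituting `γ_m - t^m/m` for
`γ_m`, with `t` read as `p ↦ p+1` (`str_smul_subA`). This substitution sends `h_k` to `h_k - t
h_{k-1}`. Column operations by the same rule turn a Jacobi-Trudi determinant into a smaller one, so
each row peels off one dressed fermion (`det_hInt_succ`, `subA_det_ket`), provided that
`h_m(-A_r)|N+1⟩ = str_m|N⟩` (`subA_h_ket`).

The Fock space carries a contravariant form in which `ψ_m` and `ψ*_m` are adjoint; then `H_m` is
adjoint to `H_{-m}`, which is `-A_m` for `r = 1`. So `⟨n|f(H) g(-A_r)|n⟩` pairs `f(H*)|n⟩` with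
`g(-A_r)|n⟩`, and orthonormality of the vectors `|λ, n⟩` (`form_basisKet`) gives `r_λ(n) δ` on Schur
functions.

For the undeformed product, the Heisenberg relation makes `H_m/m` act on `f(H*)|0⟩` as `∂_m/m`,
while `⟨0|` reads off the constant term. The same facts make `f ↦ f(H*)|0⟩` injective. As its values
lie in the span of the `|λ, 0⟩ = s_λ(H*)|0⟩`, the Schur functions span `Λ`, which gives uniqueness
of the deformed form.

Commutation of modes and `subA_h_ket` share one device: a statement on a vacuum is transported from
a much lower vacuum, where every unwanted term contains a `ψ_i` that is killed on the way up because
`ψ_i² = 0` (`raise_smul_of_mem`). -/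

theorem ψ_mul_self (m : ℤ) : ψ m * ψ m = 0 := by
  have := ψ_anticomm m m
  rwa [← two_smul ℂ, smul_eq_zero_iff_right (two_ne_zero)] at this

theorem ψs_mul_self (m : ℤ) : ψs m * ψs m = 0 := by
  have := ψs_anticomm m m
  rwa [← two_smul ℂ, smul_eq_zero_iff_right (two_ne_zero)] at this

theorem ψ_mul_swap (m n : ℤ) : ψ m * ψ n = -(ψ n * ψ m) :=
  eq_neg_of_add_eq_zero_left (ψ_anticomm m n)

theorem ψs_mul_swap (m n : ℤ) : ψs m * ψs n = -(ψs n * ψs m) :=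
  eq_neg_of_add_eq_zero_left (ψs_anticomm m n)

theorem ψ_smul_swap (m n : ℤ) (v : Fock) : ψ m • ψ n • v = -(ψ n • ψ m • v) := by
  rw [smul_smul, ψ_mul_swap, neg_smul, mul_smul]

theorem ψ_smul_self (m : ℤ) (v : Fock) : ψ m • ψ m • v = 0 := by
  rw [smul_smul, ψ_mul_self, zero_smul]

theorem ψs_smul_swap (m n : ℤ) (v : Fock) : ψs m • ψs n • v = -(ψs n • ψs m • v) := by
  rw [smul_smul, ψs_mul_swap, neg_smul, mul_smul]

theorem ψs_smul_self (m : ℤ) (v : Fock) : ψs m • ψs m • v = 0 := by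
  rw [smul_smul, ψs_mul_self, zero_smul]

theorem ψ_smul_ψs_of_ne {m n : ℤ} (h : m ≠ n) (v : Fock) :
    ψ m • ψs n • v = -(ψs n • ψ m • v) := by
  rw [smul_smul, ψ_mul_ψs_of_ne h, neg_smul, mul_smul]

theorem ψs_smul_ψ_of_ne {m n : ℤ} (h : m ≠ n) (v : Fock) :
    ψs m • ψ n • v = -(ψ n • ψs m • v) := by
  rw [ψ_smul_ψs_of_ne h.symm, neg_neg]

theorem ψ_smul_ψs_self (m : ℤ) (v : Fock) : ψ m • ψs m • v = v - ψs m • ψ m • v := by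
  rw [eq_sub_iff_add_eq, smul_smul, smul_smul, ← add_smul, ψ_ψs_anticomm, if_pos rfl, one_smul]

theorem ψs_smul_ψ_self (m : ℤ) (v : Fock) : ψs m • ψ m • v = v - ψ m • ψs m • v := by
  rw [ψ_smul_ψs_self, sub_sub_cancel]

theorem ket_natCast (N : ℕ) : ket N = raiseKet N • vac := by
  simp [ket]

theorem ket_neg_natCast (N : ℕ) : ket (-N) = lowerKet N • vac := by
  rcases Nat.eq_zero_or_pos N with rfl | hN
  · simp [ket, raiseKet, lowerKet]
  · rw [ket, if_neg (by omega)]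
    simp

theorem ket_zero : ket 0 = vac := by simp [ket, raiseKet]

theorem ket_natCast_annihilated (N : ℕ) :
    (∀ m : ℤ, m < N → ψ m • ket N = 0) ∧ ∀ m : ℤ, N ≤ m → ψs m • ket N = 0 := by
  induction N with
  | zero =>
    simp only [Nat.cast_zero, ket_zero]
    exact ⟨fun m hm => ψ_smul_vac hm, fun m hm => ψs_smul_vac hm⟩
  | succ N ih =>
    have e : ket ((N + 1 : ℕ) : ℤ) = ψ N • ket N := by
      rw [ket_natCast, ket_natCast, raiseKet, mul_smul]
    rw [e]
    push_cast
    refine ⟨fun m hm => ?_, fun m hm => ?_⟩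
    · rcases eq_or_ne m N with rfl | hne
      · rw [ψ_smul_self]
      · rw [ψ_smul_swap, ih.1 m (by omega), smul_zero, neg_zero]
    · rw [ψs_smul_ψ_of_ne (by omega), ih.2 m (by omega), smul_zero, neg_zero]

theorem ket_neg_natCast_annihilated (N : ℕ) :
    (∀ m : ℤ, m < -N → ψ m • ket (-N) = 0) ∧ ∀ m : ℤ, -N ≤ m → ψs m • ket (-N) = 0 := by
  induction N with
  | zero =>
    simp only [Nat.cast_zero, neg_zero, ket_zero]
    exact ⟨fun m hm => ψ_smul_vac hm, fun m hm => ψs_smul_vac hm⟩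
  | succ N ih =>
    have e : ket (-((N + 1 : ℕ) : ℤ)) = ψs (-(N + 1)) • ket (-N) := by
      rw [ket_neg_natCast, ket_neg_natCast, lowerKet, mul_smul]
    rw [e]
    push_cast
    refine ⟨fun m hm => ?_, fun m hm => ?_⟩
    · rw [ψ_smul_ψs_of_ne (by omega), ih.1 m (by omega), smul_zero, neg_zero]
    · rcases eq_or_ne m (-(N + 1)) with rfl | hne
      · rw [ψs_smul_self]
      · rw [ψs_smul_swap, ih.2 m (by omega), smul_zero, neg_zero]

theorem ψ_smul_ket {m n : ℤ} (hm : m < n) : ψ m • ket n = 0 := by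
  obtain ⟨N, rfl | rfl⟩ := n.eq_nat_or_neg
  · exact (ket_natCast_annihilated N).1 m hm
  · exact (ket_neg_natCast_annihilated N).1 m hm

theorem ψs_smul_ket {m n : ℤ} (hm : n ≤ m) : ψs m • ket n = 0 := by
  obtain ⟨N, rfl | rfl⟩ := n.eq_nat_or_neg
  · exact (ket_natCast_annihilated N).2 m hm
  · exact (ket_neg_natCast_annihilated N).2 m hm

theorem ψ_smul_ket_self (n : ℤ) : ψ n • ket n = ket (n + 1) := by
  obtain ⟨N, rfl | rfl⟩ := n.eq_nat_or_neg
  · rw [show (N : ℤ) + 1 = (N + 1 : ℕ) by push_cast; rfl, ket_natCast, ket_natCast, raiseKet,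
      mul_smul]
  · rcases N with _ | N
    · rw [show (-((0 : ℕ) : ℤ)) + 1 = (1 : ℕ) by simp, ket_natCast]
      simp [ket_zero, raiseKet]
    · have e : ket (-((N + 1 : ℕ) : ℤ)) = ψs (-(N + 1)) • ket (-N) := by
        rw [ket_neg_natCast, ket_neg_natCast, lowerKet, mul_smul]
      rw [e, show (-((N + 1 : ℕ) : ℤ)) + 1 = -N by push_cast; ring]
      push_cast
      rw [ψ_smul_ψs_self, ψ_smul_ket (by omega), smul_zero, sub_zero]

theorem ψ_smul_ket_pred (n : ℤ) : ψ (n - 1) • ket (n - 1) = ket n := by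
  rw [ψ_smul_ket_self, sub_add_cancel]

/-! ### Bilinear modes `∑ i, c i ψ_i ψ*_{i+k}` -/

theorem finite_mode (c : ℤ → ℂ) {k : ℤ} (hk : k ≠ 0) (v : Fock) :
    {i : ℤ | (c i • (ψ i * ψs (i + k))) • v ≠ 0}.Finite := by
  refine (finite_ψ_ψs hk v).subset fun i hi h => hi ?_
  rw [smul_assoc, h, smul_zero]

/-- The operator `∑ i, c i ψ_i ψ*_{i+k}`. -/
def mode (c : ℤ → ℂ) (k : ℤ) (hk : k ≠ 0) : Module.End ℂ Fock :=
  locSum (fun i => c i • (ψ i * ψs (i + k))) (finite_mode c hk)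

theorem mode_apply (c : ℤ → ℂ) {k : ℤ} (hk : k ≠ 0) (v : Fock) :
    mode c k hk v = ∑ᶠ i, (c i • (ψ i * ψs (i + k))) • v := rfl

theorem H_eq_mode (k : ℤ) (hk : k ≠ 0) : H k hk = mode (fun _ => 1) k hk := by
  refine LinearMap.ext fun v => finsum_congr fun i => ?_
  dsimp only
  rw [one_smul]

theorem neg_Amode_eq_mode (r : ℤ → ℂ) (k : ℕ+) :
    -Amode r k = mode (fun i => ∏ j ∈ Finset.range k, r (i - j)) (-k) (by simp) := by
  refine LinearMap.ext fun v => ?_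
  simp only [LinearMap.neg_apply, Amode, mode, locSum, LinearMap.coe_mk, AddHom.coe_mk]
  rw [← finsum_neg_distrib]
  refine finsum_congr fun i => ?_
  rw [← sub_eq_add_neg, ψ_mul_ψs_of_ne (by have := k.pos; omega), smul_neg, neg_smul]

/-- A bilinear `ψ_i ψ*_{i+k}` commutes with `ψ_j` except when `ψ*_{i+k}` contracts with it, that is
for `i = j - k`. -/
theorem mode_ψ_smul (c : ℤ → ℂ) {k : ℤ} (hk : k ≠ 0) (j : ℤ) (v : Fock) :
    mode c k hk (ψ j • v) = ψ j • mode c k hk v + c (j - k) • ψ (j - k) • v := by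
  have key : ∀ i, (c i • (ψ i * ψs (i + k))) • ψ j • v =
      ψ j • (c i • (ψ i * ψs (i + k))) • v
        + if i = j - k then c i • ψ i • v else 0 := fun i => by
    split_ifs with hi
    · subst hi
      simp only [sub_add_cancel, smul_assoc, mul_smul]
      rw [ψs_smul_ψ_self, smul_sub, ψ_smul_swap (j - k), sub_neg_eq_add, smul_add,
        smul_comm (ψ j) (c (j - k)), add_comm]
    · simp only [smul_assoc, mul_smul]
      rw [ψs_smul_ψ_of_ne (by omega), smul_neg, ψ_smul_swap, neg_neg, add_zero, smul_comm (ψ j) (c i)]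
  rw [mode_apply, finsum_congr key, finsum_add_distrib, ← smul_finsum' _ (finite_mode c hk v),
    ← mode_apply, finsum_eq_single _ (j - k), if_pos rfl]
  · intro x hx
    rw [if_neg hx]
  · refine (finite_mode c hk v).subset fun i hi h => hi ?_
    simp only [h, smul_zero]
  · refine (Set.finite_singleton (j - k)).subset fun i hi => ?_
    by_contra h
    exact hi (if_neg h)

theorem mode_ψs_smul (c : ℤ → ℂ) {k : ℤ} (hk : k ≠ 0) (j : ℤ) (v : Fock) :
    mode c k hk (ψs j • v) = ψs j • mode c k hk v - c j • ψs (j + k) • v := by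
  have key : ∀ i, (c i • (ψ i * ψs (i + k))) • ψs j • v =
      ψs j • (c i • (ψ i * ψs (i + k))) • v
        + if i = j then -(c i • ψs (i + k) • v) else 0 := fun i => by
    split_ifs with hi
    · subst hi
      simp only [smul_assoc, mul_smul]
      rw [ψs_smul_swap, smul_neg, ψ_smul_ψs_self, smul_comm (ψs i) (c i), ← smul_neg, ← smul_add]
      congr 1
      abel
    · simp only [smul_assoc, mul_smul]
      rw [ψs_smul_swap, smul_neg, ψ_smul_ψs_of_ne hi, neg_neg, add_zero, smul_comm (ψs j) (c i)]
  rw [mode_apply, finsum_congr key, finsum_add_distrib, ← smul_finsum' _ (finite_mode c hk v),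
    ← mode_apply, finsum_eq_single _ j, if_pos rfl, sub_eq_add_neg]
  · intro x hx
    rw [if_neg hx]
  · refine (finite_mode c hk v).subset fun i hi h => hi ?_
    simp only [h, smul_zero]
  · refine (Set.finite_singleton j).subset fun i hi => ?_
    by_contra h
    exact hi (if_neg h)

/-- Modes with `k > 0` annihilate the charged vacua. -/
theorem mode_ket (c : ℤ → ℂ) {k : ℤ} (hk : 0 < k) (n : ℤ) : mode c k hk.ne' (ket n) = 0 := by
  rw [mode_apply]
  refine finsum_eq_zero_of_forall_eq_zero fun i => ?_
  rw [smul_assoc, mul_smul]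
  rcases lt_or_ge i n with h | h
  · rw [ψ_smul_ψs_of_ne (by omega), ψ_smul_ket h, smul_zero, neg_zero, smul_zero]
  · rw [ψs_smul_ket (by omega), smul_zero, smul_zero]

/-- Only `k` terms survive: `ψ_i` needs an empty level `i ≥ n`, and `ψ*_{i-k}` an occupied one, `i -
k < n`. -/
theorem mode_neg_ket (c : ℤ → ℂ) (k : ℕ) (hk : -(k : ℤ) ≠ 0) (n : ℤ) :
    mode c (-k) hk (ket n) =
      ∑ s ∈ Finset.range k, c (n + s) • ψ (n + s) • ψs (n + s - k) • ket n := by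
  rw [mode_apply, finsum_eq_sum_of_support_subset (s := (Finset.range k).image
    fun s : ℕ => n + (s : ℤ)), Finset.sum_image]
  · refine Finset.sum_congr rfl fun s _ => ?_
    simp only [smul_assoc, mul_smul, sub_eq_add_neg]
  · intro a _ b _ hab
    simpa using hab
  · intro i hi
    rw [Finset.mem_coe, Finset.mem_image]
    by_contra h
    refine hi ?_
    simp only [smul_assoc, mul_smul]
    rcases lt_or_ge i n with h1 | h1
    · rw [ψ_smul_ψs_of_ne (by omega), ψ_smul_ket h1, smul_zero, neg_zero, smul_zero]
    · rw [ψs_smul_ket, smul_zero, smul_zero]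
      by_contra h2
      exact h ⟨(i - n).toNat, by simp; omega, by simp; omega⟩

/-! ### Operators commuting with fermions -/

theorem map_ι_smul {D : Module.End ℂ Fock} (h1 : ∀ j v, D (ψ j • v) = ψ j • D v)
    (h2 : ∀ j v, D (ψs j • v) = ψs j • D v) (w : W) (v : Fock) :
    D (CliffordAlgebra.ι Q w • v) = CliffordAlgebra.ι Q w • D v := by
  obtain ⟨f, g⟩ := w
  have hf : D (CliffordAlgebra.ι Q (f, 0) • v) = CliffordAlgebra.ι Q (f, 0) • D v := by
    induction f using Finsupp.induction_linear with
    | zero => rw [show ((0, 0) : W) = 0 from rfl, map_zero, zero_smul, zero_smul, map_zero]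
    | add f f' hf hf' =>
      rw [show ((f + f', 0) : W) = (f, 0) + (f', 0) by simp, map_add, add_smul, map_add, hf, hf',
        add_smul]
    | single m a =>
      have : CliffordAlgebra.ι Q (Finsupp.single m a, 0) = a • ψ m := by
        rw [ψ, ← map_smul]
        simp
      rw [this, smul_assoc, map_smul, h1, smul_assoc]
  have hg : D (CliffordAlgebra.ι Q (0, g) • v) = CliffordAlgebra.ι Q (0, g) • D v := by
    induction g using Finsupp.induction_linear with
    | zero => rw [show ((0, 0) : W) = 0 from rfl, map_zero, zero_smul, zero_smul, map_zero]
    | add f f' hf hf' =>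
      rw [show ((0, f + f') : W) = (0, f) + (0, f') by simp, map_add, add_smul, map_add, hf, hf',
        add_smul]
    | single m a =>
      have : CliffordAlgebra.ι Q (0, Finsupp.single m a) = a • ψs m := by
        rw [ψs, ← map_smul]
        simp
      rw [this, smul_assoc, map_smul, h2, smul_assoc]
  rw [show ((f, g) : W) = (f, 0) + (0, g) by simp, map_add, add_smul, map_add, hf, hg, add_smul]

theorem mk_eq_smul_vac (a : A) : (Submodule.Quotient.mk a : Fock) = a • vac := by
  rw [vac, ← Submodule.Quotient.mk_smul, smul_eq_mul, mul_one]

theorem exists_smul_vac (v : Fock) : ∃ a : A, v = a • vac := by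
  obtain ⟨a, rfl⟩ := Submodule.Quotient.mk_surjective _ v
  exact ⟨a, mk_eq_smul_vac a⟩

/-- Operators commuting with all fermions are determined by their action on the vacuum. -/
theorem end_eq_zero {D : Module.End ℂ Fock} (h1 : ∀ j v, D (ψ j • v) = ψ j • D v)
    (h2 : ∀ j v, D (ψs j • v) = ψs j • D v) (h0 : D vac = 0) : D = 0 := by
  refine LinearMap.ext fun v => ?_
  obtain ⟨a, rfl⟩ := exists_smul_vac v
  rw [LinearMap.zero_apply]
  induction a using CliffordAlgebra.left_induction with
  | algebraMap c => rw [algebraMap_smul, map_smul, h0, smul_zero]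
  | add x y hx hy => rw [add_smul, map_add, hx, hy, add_zero]
  | ι_mul x w hx => rw [mul_smul, map_ι_smul h1 h2, hx, smul_zero]

/-! ### Locality -/

/-- The span of the vectors `ψ_i v` with `N ≤ i < N + d`. -/
def upperSpan (N : ℤ) (d : ℕ) : Submodule ℂ Fock :=
  Submodule.span ℂ {v | ∃ i : ℤ, ∃ u : Fock, N ≤ i ∧ i < N + d ∧ v = ψ i • u}

theorem ψ_smul_mem_upperSpan {N : ℤ} {d : ℕ} {i : ℤ} (h1 : N ≤ i) (h2 : i < N + d) (u : Fock) :
    ψ i • u ∈ upperSpan N d :=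
  Submodule.subset_span ⟨i, u, h1, h2, rfl⟩

/-- Commuting the mode past `ψ_i` leaves either `ψ_i` or `ψ_{i+k}` in front, so the window of
momenta grows upwards by `k`. -/
theorem mode_mem_upperSpan (c : ℤ → ℂ) (k : ℕ) (hk : -(k : ℤ) ≠ 0) {N : ℤ} {d : ℕ} {v : Fock}
    (hv : v ∈ upperSpan N d) : mode c (-k) hk v ∈ upperSpan N (k + d) := by
  induction hv using Submodule.span_induction with
  | mem x hx =>
    obtain ⟨i, u, h1, h2, rfl⟩ := hx
    rw [mode_ψ_smul]
    exact add_mem (ψ_smul_mem_upperSpan h1 (by push_cast; omega) _)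
      (Submodule.smul_mem _ _ (ψ_smul_mem_upperSpan (by omega) (by push_cast; omega) _))
  | zero => simp
  | add x y _ _ hx hy => rw [map_add]; exact add_mem hx hy
  | smul a x _ hx => rw [map_smul]; exact Submodule.smul_mem _ _ hx

theorem mode_ket_mem_upperSpan (c : ℤ → ℂ) (k : ℕ) (hk : -(k : ℤ) ≠ 0) (N : ℤ) :
    mode c (-k) hk (ket N) ∈ upperSpan N k := by
  rw [mode_neg_ket]
  refine Submodule.sum_mem _ fun s hs => Submodule.smul_mem _ _ (ψ_smul_mem_upperSpan ?_ ?_ _)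
  · omega
  · have := Finset.mem_range.mp hs
    omega

/-- `ψ_{N+l-1} ⋯ ψ_{N+1} ψ_N`. -/
def raise (N : ℤ) : ℕ → A
  | 0 => 1
  | l + 1 => ψ (N + l) * raise N l

theorem raise_smul_ket (N : ℤ) (l : ℕ) : raise N l • ket N = ket (N + l) := by
  induction l with
  | zero => simp [raise]
  | succ l ih => rw [raise, mul_smul, ih, ψ_smul_ket_self]; push_cast; rw [add_assoc]

theorem raise_smul_ψ_smul {N : ℤ} {l : ℕ} {i : ℤ} (h1 : N ≤ i) (h2 : i < N + l) (u : Fock) :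
    raise N l • ψ i • u = 0 := by
  have swap : ∀ l : ℕ, ∀ u : Fock, ∃ c : ℂ, raise N l • ψ i • u = c • ψ i • raise N l • u := by
    intro l
    induction l with
    | zero => exact fun u => ⟨1, by simp [raise]⟩
    | succ l ih =>
      intro u
      obtain ⟨c, hc⟩ := ih u
      refine ⟨-c, ?_⟩
      rw [raise, mul_smul, hc, smul_comm, ψ_smul_swap, mul_smul, smul_neg, neg_smul]
  induction l with
  | zero => simp at h2; omega
  | succ l ih =>
    rw [raise, mul_smul]
    rcases eq_or_ne i (N + l) with rfl | hne
    · obtain ⟨c, hc⟩ := swap l u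
      rw [hc, smul_comm, ψ_smul_self, smul_zero]
    · rw [ih (by push_cast at h2; omega), smul_zero]

/-- Each spanning vector starts with a fermion that already occurs in `raise N l`, and fermions
square to zero. -/
theorem raise_smul_of_mem {N : ℤ} {l d : ℕ} (hd : d ≤ l) {v : Fock} (hv : v ∈ upperSpan N d) :
    raise N l • v = 0 := by
  induction hv using Submodule.span_induction with
  | mem x hx =>
    obtain ⟨i, u, h1, h2, rfl⟩ := hx
    exact raise_smul_ψ_smul h1 (by omega) u
  | zero => simp
  | add x y _ _ hx hy => rw [smul_add, hx, hy, add_zero]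
  | smul a x _ hx => rw [smul_comm, hx, smul_zero]

theorem map_raise_smul {D : Module.End ℂ Fock} (h1 : ∀ j v, D (ψ j • v) = ψ j • D v) (N : ℤ)
    (l : ℕ) (v : Fock) : D (raise N l • v) = raise N l • D v := by
  induction l with
  | zero => simp [raise]
  | succ l ih => rw [raise, mul_smul, h1, ih, mul_smul]

/-! ### Commutation relations of the modes -/

theorem commutator_ψ_smul {X Y : Module.End ℂ Fock} {x y : ℤ → ℂ} {j k : ℤ}
    (hX : ∀ i v, X (ψ i • v) = ψ i • X v + x (i - j) • ψ (i - j) • v)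
    (hY : ∀ i v, Y (ψ i • v) = ψ i • Y v + y (i - k) • ψ (i - k) • v)
    (hxy : ∀ i, y (i - k) * x (i - k - j) = x (i - j) * y (i - j - k)) (i : ℤ) (v : Fock) :
    (X * Y - Y * X) (ψ i • v) = ψ i • (X * Y - Y * X) v := by
  simp only [LinearMap.sub_apply, Module.End.mul_apply, hX, hY, map_add, map_smul, smul_add,
    smul_sub, smul_smul, hxy]
  rw [sub_right_comm i k j]
  abel

theorem commutator_ψs_smul {X Y : Module.End ℂ Fock} {x y : ℤ → ℂ} {j k : ℤ}
    (hX : ∀ i v, X (ψs i • v) = ψs i • X v - x i • ψs (i + j) • v)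
    (hY : ∀ i v, Y (ψs i • v) = ψs i • Y v - y i • ψs (i + k) • v)
    (hxy : ∀ i, y i * x (i + k) = x i * y (i + j)) (i : ℤ) (v : Fock) :
    (X * Y - Y * X) (ψs i • v) = ψs i • (X * Y - Y * X) v := by
  simp only [LinearMap.sub_apply, Module.End.mul_apply, hX, hY, map_sub, map_smul,
    smul_sub, smul_smul, hxy]
  rw [add_right_comm i k j]
  abel

/-- The hypothesis says that the two weighted shifts on one-particle states commute. What remains of
the commutator is then at most a central term, to be found from its value on the vacuum. -/
theorem mode_mul_sub (x y : ℤ → ℂ) {j k : ℤ} (hj : j ≠ 0) (hk : k ≠ 0)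
    (hxy : ∀ i, y i * x (i + k) = x i * y (i + j)) :
    (∀ i v, (mode x j hj * mode y k hk - mode y k hk * mode x j hj) (ψ i • v) =
      ψ i • (mode x j hj * mode y k hk - mode y k hk * mode x j hj) v) ∧
    (∀ i v, (mode x j hj * mode y k hk - mode y k hk * mode x j hj) (ψs i • v) =
      ψs i • (mode x j hj * mode y k hk - mode y k hk * mode x j hj) v) := by
  refine ⟨commutator_ψ_smul (mode_ψ_smul x hj) (mode_ψ_smul y hk) fun i => ?_,
    commutator_ψs_smul (mode_ψs_smul x hj) (mode_ψs_smul y hk) hxy⟩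
  have := hxy (i - j - k)
  rw [sub_add_cancel, show i - j - k + j = i - k by ring] at this
  rw [show i - k - j = i - j - k by ring]
  linear_combination -this

theorem commute_mode_pos (x y : ℤ → ℂ) {j k : ℤ} (hj : 0 < j) (hk : 0 < k)
    (hxy : ∀ i, y i * x (i + k) = x i * y (i + j)) :
    Commute (mode x j hj.ne') (mode y k hk.ne') := by
  obtain ⟨h1, h2⟩ := mode_mul_sub x y hj.ne' hk.ne' hxy
  refine sub_eq_zero.mp (end_eq_zero h1 h2 ?_)
  rw [← ket_zero]
  simp [mode_ket x hj, mode_ket y hk]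

/-- Since the commutator commutes with all fermions, its value on `|0⟩` comes from its value on
`|-(j+k)⟩` by raising. The latter lies in a window of width `j + k`, exactly what the raising
operator annihilates. -/
theorem commute_mode_neg (x y : ℤ → ℂ) {j k : ℕ} (hj : -(j : ℤ) ≠ 0) (hk : -(k : ℤ) ≠ 0)
    (hxy : ∀ i, y i * x (i + -k) = x i * y (i + -j)) :
    Commute (mode x (-j) hj) (mode y (-k) hk) := by
  obtain ⟨h1, h2⟩ := mode_mul_sub x y hj hk hxy
  refine sub_eq_zero.mp (end_eq_zero h1 h2 ?_)
  have e := raise_smul_ket (-((j + k : ℕ) : ℤ)) (j + k)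
  rw [neg_add_cancel, ket_zero] at e
  rw [← e, map_raise_smul h1]
  refine raise_smul_of_mem le_rfl ?_
  rw [LinearMap.sub_apply, Module.End.mul_apply, Module.End.mul_apply]
  refine sub_mem (mode_mem_upperSpan _ _ _ (mode_ket_mem_upperSpan _ _ _ _)) ?_
  rw [add_comm]
  exact mode_mem_upperSpan _ _ _ (mode_ket_mem_upperSpan _ _ _ _)

/-- The commutator is computed on `|-k⟩` and transported to `|0⟩`: each of the `k` terms of
`H_{-k}|-k⟩` contributes one vacuum if `j = k` and nothing otherwise. -/
theorem H_mul_H_neg (j k : ℕ+) :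
    H j (by simp) * H (-k) (by simp) - H (-k) (by simp) * H j (by simp) =
      (if j = k then (j : ℂ) else 0) • (1 : Module.End ℂ Fock) := by
  have hj : (j : ℤ) ≠ 0 := by simp
  have hk : (-(k : ℕ) : ℤ) ≠ 0 := by simp
  obtain ⟨h1, h2⟩ := mode_mul_sub (fun _ => 1) (fun _ => 1) hj hk fun i => rfl
  rw [← sub_eq_zero, H_eq_mode, H_eq_mode]
  set D := mode (fun _ => 1) (j : ℤ) hj * mode (fun _ => 1) (-(k : ℕ)) hk -
    mode (fun _ => 1) (-(k : ℕ)) hk * mode (fun _ => 1) (j : ℤ) hj with hD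
  refine end_eq_zero (fun i v => ?_) (fun i v => ?_) ?_
  · rw [LinearMap.sub_apply D, LinearMap.sub_apply D, h1, smul_sub, LinearMap.smul_apply,
      LinearMap.smul_apply, Module.End.one_apply, Module.End.one_apply, smul_comm]
  · rw [LinearMap.sub_apply D, LinearMap.sub_apply D, h2, smul_sub, LinearMap.smul_apply,
      LinearMap.smul_apply, Module.End.one_apply, Module.End.one_apply, smul_comm]
  have e := raise_smul_ket (-((k : ℕ) : ℤ)) k
  rw [neg_add_cancel, ket_zero] at e
  rw [LinearMap.sub_apply, ← e, map_raise_smul h1, hD, LinearMap.sub_apply, Module.End.mul_apply,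
    Module.End.mul_apply, mode_ket _ (by simp : (0 : ℤ) < j), map_zero, sub_zero, mode_neg_ket,
    map_sum, Finset.smul_sum]
  -- Moving `H_j` past `ψ_{-k+s}` leaves a term killed by raising and a term with `ψ_{-k+s-j}`. The
  -- latter restores `|-k⟩` if `j = k`; otherwise it vanishes, either on `|-k⟩` or under raising.
  have term : ∀ s ∈ Finset.range k, raise (-((k : ℕ) : ℤ)) k • mode (fun _ => 1) (j : ℤ) hj
      ((1 : ℂ) • ψ (-(k : ℕ) + s) • ψs (-(k : ℕ) + s - (k : ℕ)) • ket (-(k : ℕ))) =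
      if j = k then vac else 0 := fun s hs => by
    have hs' := Finset.mem_range.mp hs
    rw [one_smul, mode_ψ_smul, smul_add, raise_smul_ψ_smul (by omega) (by omega), zero_add,
      one_smul]
    split_ifs with hjk
    · subst hjk
      rw [ψ_smul_ψs_self, ψ_smul_ket (by omega), smul_zero, sub_zero, e]
    · have hjk' : (j : ℤ) ≠ k := fun h => hjk (by exact_mod_cast h)
      rcases lt_or_ge (-(k : ℕ) + (s : ℤ) - j) (-(k : ℕ)) with h | h
      · rw [ψ_smul_ψs_of_ne (by omega), ψ_smul_ket h, smul_zero, neg_zero, smul_zero]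
      · rw [raise_smul_ψ_smul h (by have := j.pos; omega)]
  rw [Finset.sum_congr rfl term, Finset.sum_const, Finset.card_range, e]
  split_ifs with hjk
  · subst hjk
    simp [Nat.cast_smul_eq_nsmul]
  · simp

theorem Hvec_eq_mode (m : ℕ+) : Hvec m = ((m : ℂ)⁻¹) • mode (fun _ => 1) (m : ℤ) (by simp) := by
  rw [Hvec, H_eq_mode]

theorem commute_Hvec (j k : ℕ+) : Commute (Hvec j) (Hvec k) := by
  rw [Hvec_eq_mode, Hvec_eq_mode]
  exact ((commute_mode_pos _ _ (by simp : (0 : ℤ) < j) (by simp : (0 : ℤ) < k) fun _ => rfl).smul_left _).smul_right _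

theorem commute_HstarVec (j k : ℕ+) : Commute (HstarVec j) (HstarVec k) := by
  rw [HstarVec, HstarVec, H_eq_mode, H_eq_mode]
  exact ((commute_mode_neg _ _ (by simp : -((j : ℕ) : ℤ) ≠ 0) (by simp : -((k : ℕ) : ℤ) ≠ 0) fun _ => rfl).smul_left _).smul_right _

theorem neg_Avec_eq_mode (r : ℤ → ℂ) (m : ℕ+) : -Avec r m =
    ((m : ℂ)⁻¹) • mode (fun i => ∏ s ∈ Finset.range m, r (i - s)) (-(m : ℕ)) (by simp) := by
  have : -Avec r m = ((m : ℂ)⁻¹) • -Amode r m := by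
    rw [Avec, smul_neg]
  rw [this, neg_Amode_eq_mode]

/-- The right side is symmetric in `a` and `b`, which is the one-particle condition needed for the
modes `A_k` to commute. -/
theorem prod_shift_mul (r : ℤ → ℂ) (a b : ℕ) (i : ℤ) :
    (∏ s ∈ Finset.range a, r (i - s)) * ∏ s ∈ Finset.range b, r (i + -a - s) =
      ∏ s ∈ Finset.range (a + b), r (i - s) := by
  rw [Finset.prod_range_add]
  congr 1
  refine Finset.prod_congr rfl fun s _ => ?_
  push_cast
  ring_nf

theorem commute_neg_Avec (r : ℤ → ℂ) (j k : ℕ+) : Commute (-Avec r j) (-Avec r k) := by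
  rw [neg_Avec_eq_mode, neg_Avec_eq_mode]
  refine ((commute_mode_neg _ _ (by simp : -((j : ℕ) : ℤ) ≠ 0) (by simp : -((k : ℕ) : ℤ) ≠ 0) fun i => ?_).smul_left _).smul_right _
  rw [prod_shift_mul, prod_shift_mul, add_comm]

theorem commute_Avec (r : ℤ → ℂ) (j k : ℕ+) : Commute (Avec r j) (Avec r k) := by
  have := (commute_neg_Avec r j k).neg_left.neg_right
  rwa [neg_neg, neg_neg] at this

theorem HstarVec_eq_neg_Avec (m : ℕ+) : HstarVec m = -Avec (fun _ => 1) m := by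
  rw [neg_Avec_eq_mode, HstarVec, H_eq_mode]
  simp

/-! ### Substitution of commuting operators -/

section evalHom

variable {V : Type*} [AddCommGroup V] [Module ℂ V] {X : ℕ+ → Module.End ℂ V}

/-- Substitution of commuting operators as an algebra homomorphism. -/
def evalHom (hX : ∀ j k, Commute (X j) (X k)) : Sym →ₐ[ℂ] Module.End ℂ V :=
  -- Polynomial evaluation needs a commutative target, so it is done in the subalgebra generated by
  -- the commuting operators.
  letI : CommRing (Algebra.adjoin ℂ (Set.range X)) :=
    { (Algebra.adjoin ℂ (Set.range X)).toRing with
      mul_comm := (Algebra.isMulCommutative_adjoin ℂ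
        (by rintro _ ⟨j, rfl⟩ _ ⟨k, rfl⟩; exact hX j k)).is_comm.comm }
  (Algebra.adjoin ℂ (Set.range X)).val.comp
    (MvPolynomial.aeval fun m => ⟨X m, Algebra.subset_adjoin ⟨m, rfl⟩⟩)

theorem evalHom_X (hX : ∀ j k, Commute (X j) (X k)) (m : ℕ+) :
    evalHom hX (MvPolynomial.X m) = X m := by
  simp [evalHom]

theorem evalHom_C (hX : ∀ j k, Commute (X j) (X k)) (c : ℂ) :
    evalHom hX (MvPolynomial.C c) = c • (1 : Module.End ℂ V) := by
  rw [← MvPolynomial.algebraMap_eq, AlgHom.commutes, Algebra.algebraMap_eq_smul_one]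

theorem evalOps_eq_evalHom (hX : ∀ j k, Commute (X j) (X k)) (f : Sym) :
    evalOps X f = evalHom hX f := by
  conv_rhs => rw [f.as_sum, map_sum]
  refine Finset.sum_congr rfl fun m _ => ?_
  rw [← mul_one (f.coeff m), ← smul_eq_mul, ← MvPolynomial.smul_monomial, map_smul, smul_eq_mul,
    mul_one]
  congr 1
  have : MvPolynomial.monomial m (1 : ℂ) =
      ((m.support.sort (· ≤ ·)).map fun k => (MvPolynomial.X k : Sym) ^ m k).prod := by
    rw [MvPolynomial.monomial_eq, map_one, one_mul, Finsupp.prod,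
      ← List.prod_toFinset _ (Finset.sort_nodup _ _), Finset.sort_toFinset]
  rw [this, map_list_prod, List.map_map]
  congr 1
  refine List.map_congr_left fun k _ => ?_
  rw [Function.comp_apply, map_pow, evalHom_X]

end evalHom

/-! ### Complete symmetric functions -/

open PowerSeries in
/-- The series `∑ m ≥ 1, γ_m z^m`. -/
def gammaSeries : Sym⟦X⟧ :=
  PowerSeries.mk fun m => if hm : 0 < m then MvPolynomial.X (m.toPNat hm) else 0

open PowerSeries in
/-- The generating series of the complete symmetric functions. -/
def hSeries : Sym⟦X⟧ := (PowerSeries.exp Sym).subst gammaSeries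

theorem coeff_hSeries (k : ℕ) : PowerSeries.coeff k hSeries = h k := rfl

theorem coeff_succ_gammaSeries (m : ℕ) :
    PowerSeries.coeff (m + 1) gammaSeries = MvPolynomial.X m.succPNat := by
  rw [gammaSeries, PowerSeries.coeff_mk, dif_pos (Nat.succ_pos m)]
  rfl

theorem hasSubst_gammaSeries : PowerSeries.HasSubst gammaSeries :=
  PowerSeries.HasSubst.of_constantCoeff_zero' (by
    rw [← PowerSeries.coeff_zero_eq_constantCoeff_apply]; simp [gammaSeries])

theorem derivative_hSeries :
    PowerSeries.derivative Sym hSeries = hSeries * PowerSeries.derivative Sym gammaSeries := by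
  rw [hSeries, PowerSeries.derivative_subst hasSubst_gammaSeries, PowerSeries.derivative_exp]

theorem h_zero : h 0 = 1 := by
  have : PowerSeries.constantCoeff gammaSeries = 0 := by
    rw [← PowerSeries.coeff_zero_eq_constantCoeff_apply]; simp [gammaSeries]
  rw [← coeff_hSeries, PowerSeries.coeff_zero_eq_constantCoeff_apply, hSeries]
  refine (PowerSeries.constantCoeff_subst hasSubst_gammaSeries _).trans ?_
  rw [finsum_eq_single _ 0]
  · simp
  · intro d hd
    rw [map_pow]
    change _ • (PowerSeries.constantCoeff gammaSeries) ^ d = _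
    rw [this, zero_pow hd, smul_zero]

/-! ### The shift of the power sums and its effect on complete symmetric functions. -/

open Polynomial in
/-- The homomorphism `γ_m ↦ γ_m - t^m / m`. -/
def shift : Sym →ₐ[ℂ] Sym[X] :=
  MvPolynomial.aeval fun m : ℕ+ =>
    Polynomial.C (MvPolynomial.X m) - ((m : ℂ)⁻¹) • (Polynomial.X ^ (m : ℕ) : Sym[X])

theorem shift_X (m : ℕ+) : shift (MvPolynomial.X m) =
    Polynomial.C (MvPolynomial.X m) - ((m : ℂ)⁻¹) • (Polynomial.X ^ (m : ℕ) : Polynomial Sym) :=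
  MvPolynomial.aeval_X _ _

/-- Comparing coefficients gives `(k+1) F_{k+1} = ∑ F_a P_b` over `a + b = k`, and `k + 1` is a unit
over `ℚ`. -/
theorem linear_ode_unique {R : Type*} [CommRing R] [Algebra ℚ R] {F G P : PowerSeries R}
    (hF : PowerSeries.derivative R F = F * P) (hG : PowerSeries.derivative R G = G * P)
    (h0 : PowerSeries.coeff 0 F = PowerSeries.coeff 0 G) : F = G := by
  ext k
  induction k using Nat.strong_induction_on with
  | _ k ih =>
    rcases k with _ | k
    · exact h0
    · have e1 := congrArg (PowerSeries.coeff k) hF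
      have e2 := congrArg (PowerSeries.coeff k) hG
      rw [PowerSeries.coeff_derivative, PowerSeries.coeff_mul] at e1 e2
      have e3 : PowerSeries.coeff (k + 1) F * ((k : R) + 1) =
          PowerSeries.coeff (k + 1) G * ((k : R) + 1) := by
        rw [e1, e2]
        refine Finset.sum_congr rfl fun p hp => ?_
        rw [ih p.1 (by have := Finset.HasAntidiagonal.mem_antidiagonal.mp hp; omega)]
      have u : IsUnit ((k : R) + 1) := by
        have := (IsUnit.mk0 ((k + 1 : ℕ) : ℚ) (by positivity)).map (algebraMap ℚ R)
        rwa [map_natCast, Nat.cast_succ] at this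
      exact u.mul_right_cancel e3

theorem derivative_mul_one_sub {R : Type*} [CommRing R] (F : PowerSeries R) (t : R) :
    PowerSeries.derivative R (F * (1 - PowerSeries.C t * PowerSeries.X)) =
      PowerSeries.derivative R F * (1 - PowerSeries.C t * PowerSeries.X)
        - F * PowerSeries.C t := by
  rw [Derivation.leibniz, map_sub, Derivation.leibniz, PowerSeries.derivative_X,
    PowerSeries.derivative_C, PowerSeries.derivative_one]
  simp only [smul_eq_mul]
  ring

/-- Formally, `exp(-∑ t^m z^m / m) = 1 - tz`. The proof compares logarithmic derivatives: both sides
solve the same first-order linear equation with initial value `1`. -/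
theorem shift_hSeries : hSeries.map (shift : Sym →+* Polynomial Sym) =
    hSeries.map (Polynomial.C : Sym →+* Polynomial Sym) *
      (1 - PowerSeries.C Polynomial.X * PowerSeries.X) := by
  have hmap : ∀ φ : Sym →+* Polynomial Sym, PowerSeries.derivative _ (hSeries.map φ) =
      hSeries.map φ * (PowerSeries.derivative Sym gammaSeries).map φ := fun φ => by
    rw [← map_mul, ← derivative_hSeries]
    ext1 k
    simp [PowerSeries.coeff_derivative]
  refine linear_ode_unique (hmap _) ?_ ?_
  · have key : (PowerSeries.derivative Sym gammaSeries).map (shift : Sym →+* Polynomial Sym) =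
      (PowerSeries.derivative Sym gammaSeries).map (Polynomial.C : Sym →+* Polynomial Sym) -
        PowerSeries.mk fun m => Polynomial.X ^ (m + 1) := by
      ext1 m
      have hm0 : ((m : ℂ) + 1) ≠ 0 := Nat.cast_add_one_ne_zero m
      have hm : ((m : Polynomial Sym) + 1) = algebraMap ℂ _ ((m : ℂ) + 1) := by simp
      simp only [PowerSeries.coeff_map, PowerSeries.coeff_derivative, coeff_succ_gammaSeries,
        PowerSeries.coeff_mk, map_sub, map_mul, map_add, map_natCast, map_one, RingHom.coe_coe,
        shift_X, Nat.succPNat_coe, Nat.cast_succ]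
      rw [sub_mul, sub_right_inj, hm, smul_mul_assoc, mul_comm, ← Algebra.smul_def, smul_smul,
        inv_mul_cancel₀ hm0, one_smul]
    have geo : (PowerSeries.mk fun m => (Polynomial.X : Polynomial Sym) ^ (m + 1)) *
        (1 - PowerSeries.C Polynomial.X * PowerSeries.X) = PowerSeries.C Polynomial.X := by
      ext1 m
      rcases m with _ | m
      · simp 
      · rw [mul_sub, mul_one, ← mul_assoc, map_sub, PowerSeries.coeff_succ_mul_X,
          PowerSeries.coeff_mul_C]
        simp [pow_succ]
    rw [derivative_mul_one_sub, hmap, key]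
    linear_combination hSeries.map (Polynomial.C : Sym →+* Polynomial Sym) * geo
  · have e' (φ : Sym →+* Polynomial Sym) : PowerSeries.constantCoeff (hSeries.map φ) = 1 := by
      rw [← PowerSeries.coeff_zero_eq_constantCoeff_apply, PowerSeries.coeff_map, coeff_hSeries,
        h_zero, map_one]
    rw [PowerSeries.coeff_zero_eq_constantCoeff, e', map_mul, e']
    simp

theorem hInt_natCast (k : ℕ) : hInt k = h k := by simp [hInt]

theorem hInt_of_neg {k : ℤ} (hk : k < 0) : hInt k = 0 := by simp [hInt, hk]

theorem shift_h_succ (k : ℕ) :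
    shift (h (k + 1)) = Polynomial.C (h (k + 1)) - Polynomial.X * Polynomial.C (h k) := by
  have := congrArg (PowerSeries.coeff (k + 1)) shift_hSeries
  rw [mul_sub, mul_one, ← mul_assoc, map_sub, PowerSeries.coeff_succ_mul_X,
    PowerSeries.coeff_mul_C] at this
  rw [PowerSeries.coeff_map, PowerSeries.coeff_map, PowerSeries.coeff_map, coeff_hSeries,
    coeff_hSeries, mul_comm (Polynomial.C (h k))] at this
  exact this

theorem shift_hInt (k : ℤ) :
    shift (hInt k) = Polynomial.C (hInt k) - Polynomial.X * Polynomial.C (hInt (k - 1)) := by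
  rcases lt_or_ge k 0 with hk | hk
  · simp [hInt_of_neg hk, hInt_of_neg (show k - 1 < 0 by omega)]
  · lift k to ℕ using hk
    rcases k with _ | k
    · rw [hInt_natCast, h_zero, hInt_of_neg (by simp)]
      simp
    · rw [show ((k + 1 : ℕ) : ℤ) - 1 = k by push_cast; ring, hInt_natCast, hInt_natCast,
        shift_h_succ]

/-- Expansion of a Jacobi-Trudi determinant along its first row, in terms of `shift`. -/
theorem det_hInt_succ {l : ℕ} (a : Fin (l + 1) → ℤ) (φ : Polynomial Sym →ₗ[Sym] Sym)
    (hφ : ∀ k : ℕ, φ (Polynomial.X ^ k) = hInt (a 0 + k)) :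
    φ (shift (Matrix.det (Matrix.of fun i j : Fin l => hInt (a i.succ - (i : ℤ) + j)))) =
      Matrix.det (Matrix.of fun i j : Fin (l + 1) => hInt (a i - (i : ℤ) + j)) := by
  -- The first row is replaced by the formal row `1, t, …, t^l`; applying `φ` after expansion puts
  -- the entries `h_{a_0+j}` back.
  set M : Matrix (Fin (l + 1)) (Fin (l + 1)) (Polynomial Sym) := Matrix.of
    fun i j => Fin.cases (Polynomial.X ^ (j : ℕ))
      (fun i : Fin l => Polynomial.C (hInt (a i.succ - (i.succ : ℕ) + j))) i with hM
  -- Subtracting `t` times the preceding column makes the first row `1, 0, …, 0` and turns the lower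
  -- entries into `h_k - t h_{k-1}`, the shifted ones.
  set M' : Matrix (Fin (l + 1)) (Fin (l + 1)) (Polynomial Sym) := Matrix.of
    fun i j => Fin.cases (M i 0) (fun j : Fin l => M i j.succ - Polynomial.X * M i j.castSucc) j
    with hM'
  have h1 : M.det = M'.det := by
    refine Matrix.det_eq_of_forall_col_eq_smul_add_pred (fun _ => Polynomial.X) ?_ ?_
    · intro i; simp [hM']
    · intro i j; simp [hM']
  have h2 : M'.det =
      shift (Matrix.det (Matrix.of fun i j : Fin l => hInt (a i.succ - (i : ℤ) + j))) := by
    rw [Matrix.det_succ_row_zero, Finset.sum_eq_single 0]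
    · rw [AlgHom.map_det]
      simp only [Fin.val_zero, pow_zero, one_mul]
      rw [show M' 0 0 = 1 by simp [hM', hM], one_mul]
      congr 1
      ext1 i j
      simp only [Matrix.submatrix_apply, AlgHom.mapMatrix_apply, Matrix.map_apply, Matrix.of_apply,
        shift_hInt, Fin.zero_succAbove]
      simp only [hM', hM, Matrix.of_apply, Fin.cases_succ, Fin.val_succ, Fin.val_castSucc]
      push_cast
      ring_nf
    · intro j _ hj
      obtain ⟨j, rfl⟩ := Fin.exists_succ_eq.mpr hj
      simp [hM', hM, pow_succ']
    · simp
  rw [← h2, ← h1, Matrix.det_succ_row_zero, Matrix.det_succ_row_zero, map_sum]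
  refine Finset.sum_congr rfl fun j _ => ?_
  have h3 : (M.submatrix Fin.succ j.succAbove).det = Polynomial.C (((Matrix.of
      fun i j : Fin (l + 1) => hInt (a i - (i : ℤ) + j)).submatrix Fin.succ j.succAbove).det) := by
    rw [RingHom.map_det]
    rfl
  rw [h3, show M 0 j = Polynomial.X ^ (j : ℕ) by rfl]
  set d := (((Matrix.of
      fun i j : Fin (l + 1) => hInt (a i - (i : ℤ) + j)).submatrix Fin.succ j.succAbove).det)
  rw [show (-1) ^ (j : ℕ) * (Polynomial.X : Polynomial Sym) ^ (j : ℕ) * Polynomial.C d =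
    ((-1) ^ (j : ℕ) * d) • Polynomial.X ^ (j : ℕ) by
      rw [Polynomial.smul_eq_C_mul, map_mul, map_pow, map_neg, map_one]; ring, map_smul, hφ]
  simp
  ring

/-- Newton's recursion, read off from the differential equation of the generating series. -/
theorem succ_mul_h_succ (m : ℕ) : ((m : ℂ) + 1) • h (m + 1) =
    ∑ p ∈ Finset.HasAntidiagonal.antidiagonal m, ((p.2 : ℂ) + 1) • (MvPolynomial.X p.2.succPNat * h p.1) := by
  have := congrArg (PowerSeries.coeff m) derivative_hSeries
  rw [PowerSeries.coeff_derivative, PowerSeries.coeff_mul, coeff_hSeries] at this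
  rw [Algebra.smul_def, mul_comm]
  simp only [map_add, map_natCast, map_one]
  rw [this]
  refine Finset.sum_congr rfl fun p _ => ?_
  rw [PowerSeries.coeff_derivative, coeff_succ_gammaSeries, coeff_hSeries, Algebra.smul_def]
  simp only [map_add, map_natCast, map_one]
  ring

/-! ### Substitution of the modes `-A_k` -/

section subA

variable (r : ℤ → ℂ)

/-- Substitution of `-𝐀_r`. -/
def subA : Sym →ₐ[ℂ] Module.End ℂ Fock := evalHom (commute_neg_Avec r)

theorem subA_X (m : ℕ+) : subA r (MvPolynomial.X m) = -Avec r m := evalHom_X _ m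

/-- `r(j+1) r(j+2) ⋯ r(j+p) ψ_{j+p}`. -/
def str (j : ℤ) (p : ℕ) : A := (∏ s ∈ Finset.range p, r (j + 1 + s)) • ψ (j + p)

theorem str_zero (j : ℤ) : str r j 0 = ψ j := by simp [str]

theorem str_succ (j : ℤ) (p : ℕ) : str r j (p + 1) = r (j + 1) • str r (j + 1) p := by
  rw [str, str, smul_smul, Finset.prod_range_succ', mul_comm]
  congr 1
  · congr 1
    · simp
    · refine Finset.prod_congr rfl fun s _ => ?_
      push_cast
      ring_nf
  · push_cast
    ring_nf

/-- The weights are chosen so that `r` disappears from the commutator: the factors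
`r(j+p+1)⋯r(j+p+m)` produced by the mode are those missing from the longer string. -/
theorem neg_Avec_str_smul (m : ℕ+) (j : ℤ) (p : ℕ) (v : Fock) :
    (-Avec r m) (str r j p • v) =
      str r j p • (-Avec r m) v + ((m : ℂ)⁻¹) • str r j (p + m) • v := by
  rw [neg_Avec_eq_mode]
  simp only [LinearMap.smul_apply, str, smul_assoc, map_smul, mode_ψ_smul, smul_add]
  congr 1
  · rw [smul_comm (ψ _), smul_comm (∏ s ∈ Finset.range p, r (j + 1 + s))]
  · rw [smul_comm (∏ s ∈ Finset.range p, r (j + 1 + s))]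
    congr 1
    rw [smul_smul, sub_neg_eq_add, add_assoc, Nat.cast_add]
    congr 1
    rw [Finset.prod_range_add]
    congr 1
    rw [← Finset.prod_range_reflect _ (m : ℕ)]
    refine Finset.prod_congr rfl fun s hs => ?_
    have := Finset.mem_range.mp hs
    congr 1
    push_cast [Nat.cast_sub (show s ≤ (m : ℕ) - 1 by omega), Nat.cast_sub (show 1 ≤ (m : ℕ) by omega)]
    ring

/-- The additive map `∑ c_k t^k ↦ ∑ c_k(-𝐀_r) w_k`. -/
def stringEval (w : ℕ → Fock) : Polynomial Sym →+ Fock where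
  toFun q := q.sum fun k c => subA r c (w k)
  map_zero' := Polynomial.sum_zero_index _
  map_add' p q := Polynomial.sum_add_index p q _ (by simp) (by simp)

theorem stringEval_monomial (w : ℕ → Fock) (k : ℕ) (c : Sym) :
    stringEval r w (Polynomial.monomial k c) = subA r c (w k) :=
  Polynomial.sum_monomial_index (f := fun k c => subA r c (w k)) _ (by simp)

theorem stringEval_C_mul (w : ℕ → Fock) (c : Sym) (q : Polynomial Sym) :
    stringEval r w (Polynomial.C c * q) = subA r c (stringEval r w q) := by
  induction q using Polynomial.induction_on' with
  | add p q hp hq => rw [mul_add, map_add, hp, hq, map_add, map_add]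
  | monomial k d =>
    rw [Polynomial.C_mul_monomial, stringEval_monomial, stringEval_monomial, map_mul,
      Module.End.mul_apply]

theorem stringEval_smul (w : ℕ → Fock) (c : ℂ) (q : Polynomial Sym) :
    stringEval r w (c • q) = c • stringEval r w q := by
  rw [← algebraMap_smul Sym c q, Polynomial.smul_eq_C_mul, stringEval_C_mul, AlgHom.commutes,
    Module.algebraMap_end_apply]

theorem stringEval_X_pow_mul (w : ℕ → Fock) (m : ℕ) (q : Polynomial Sym) :
    stringEval r w (Polynomial.X ^ m * q) = stringEval r (fun k => w (k + m)) q := by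
  induction q using Polynomial.induction_on' with
  | add p q hp hq => rw [mul_add, map_add, hp, hq, map_add]
  | monomial k d => rw [Polynomial.X_pow_mul_monomial, stringEval_monomial, stringEval_monomial]

/-- Multiplicativity in `f` reduces this to a single mode, where `str_p (-A_m/m) = (-A_m/m) str_p -
(1/m) str_{p+m}`; the power `t^k` records how far the string has grown. -/
theorem str_smul_subA (f : Sym) (j : ℤ) (p : ℕ) (v : Fock) :
    str r j p • subA r f v = stringEval r (fun k => str r j (p + k) • v) (shift f) := by
  induction f using MvPolynomial.induction_on generalizing p with
  | C a =>
    rw [← MvPolynomial.algebraMap_eq, AlgHom.commutes, AlgHom.commutes,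
      Module.algebraMap_end_apply, Algebra.algebraMap_eq_smul_one, stringEval_smul,
      ← Polynomial.monomial_zero_one, stringEval_monomial, map_one, Module.End.one_apply,
      add_zero, smul_comm]
  | add f g hf hg => rw [map_add, LinearMap.add_apply, smul_add, hf, hg, map_add, map_add]
  | mul_X f m hf =>
    have e := neg_Avec_str_smul r m j p (subA r f v)
    replace e := eq_sub_of_add_eq e.symm
    rw [mul_comm, map_mul, Module.End.mul_apply, subA_X, e, hf, hf, map_mul, shift_X, sub_mul,
      map_sub, stringEval_C_mul, subA_X, smul_mul_assoc, stringEval_smul, stringEval_X_pow_mul]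
    congr 4
    funext k
    rw [add_assoc, add_comm k]

theorem str_smul_h_succ (m : ℕ) (j : ℤ) (p : ℕ) (v : Fock) :
    str r j p • subA r (h (m + 1)) v =
      subA r (h (m + 1)) (str r j p • v) - subA r (h m) (str r j (p + 1) • v) := by
  rw [str_smul_subA, shift_h_succ, map_sub, ← pow_one Polynomial.X, stringEval_X_pow_mul,
    ← Polynomial.monomial_zero_left, ← Polynomial.monomial_zero_left, stringEval_monomial,
    stringEval_monomial, add_zero, zero_add]

/-- This inverts the factor `1 - tz` of the preceding exchange relation into a geometric series. -/
theorem subA_h_str_smul (m : ℕ) (j : ℤ) (p : ℕ) (v : Fock) :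
    subA r (h m) (str r j p • v) =
      ∑ q ∈ Finset.range (m + 1), str r j (p + q) • subA r (h (m - q)) v := by
  induction m generalizing p with
  | zero => simp [h_zero]
  | succ m ih =>
    rw [Finset.sum_range_succ', add_zero, Nat.sub_zero, str_smul_h_succ, ih (p + 1)]
    simp only [Nat.add_sub_add_right, add_assoc, add_comm 1]
    abel

/-- By Newton's recursion `h_{m+1}` is a combination of products `γ_{b+1} h_a` with `a + b = m`, and
the mode of index `b + 1` widens the window by `b + 1`. -/
theorem subA_h_ket_mem (m : ℕ) (N : ℤ) : subA r (h (m + 1)) (ket N) ∈ upperSpan N (m + 1) := by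
  induction m using Nat.strong_induction_on with
  | _ m ih =>
    have hm0 : ((m : ℂ) + 1) ≠ 0 := Nat.cast_add_one_ne_zero m
    rw [← Submodule.smul_mem_iff _ hm0, ← LinearMap.smul_apply, ← map_smul, succ_mul_h_succ,
      map_sum, LinearMap.sum_apply]
    refine Submodule.sum_mem _ fun p hp => ?_
    rw [Finset.HasAntidiagonal.mem_antidiagonal] at hp
    rw [map_smul, LinearMap.smul_apply, map_mul, Module.End.mul_apply, subA_X, neg_Avec_eq_mode,
      LinearMap.smul_apply]
    refine Submodule.smul_mem _ _ (Submodule.smul_mem _ _ ?_)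
    obtain ⟨a, b⟩ := p
    dsimp only at hp ⊢
    rcases a with _ | a
    · obtain rfl : b = m := by omega
      rw [h_zero, map_one, Module.End.one_apply]
      exact mode_ket_mem_upperSpan _ _ _ _
    · have := mode_mem_upperSpan (fun i => ∏ s ∈ Finset.range b.succPNat, r (i - s)) b.succPNat
        (by rw [Nat.succPNat_coe]; omega) (ih a (by omega))
      rwa [show (b.succPNat : ℕ) + (a + 1) = m + 1 by rw [Nat.succPNat_coe]; omega] at this

/-- Reversing the summation order swaps two anticommuting factors, so the sum equals its own
negative. -/
theorem sum_str_smul_str_smul (m : ℕ) (j : ℤ) (v : Fock) :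
    ∑ q ∈ Finset.range m, str r j q • str r j (m - 1 - q) • v = 0 := by
  have swap : ∀ p q, str r j p • str r j q • v = -(str r j q • str r j p • v) := fun p q => by
    simp only [str, smul_assoc]
    rw [smul_comm (ψ (j + p)) (∏ s ∈ Finset.range q, r (j + 1 + s)), ψ_smul_swap,
      smul_comm (ψ (j + q)) (∏ s ∈ Finset.range p, r (j + 1 + s)), smul_neg, smul_neg,
      smul_comm (∏ s ∈ Finset.range p, r (j + 1 + s))]
  have e := Finset.sum_range_reflect (fun q => str r j q • str r j (m - 1 - q) • v) m
  have e2 : ∑ q ∈ Finset.range m, str r j (m - 1 - q) • str r j (m - 1 - (m - 1 - q)) • v =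
      -∑ q ∈ Finset.range m, str r j q • str r j (m - 1 - q) • v := by
    rw [← Finset.sum_neg_distrib]
    refine Finset.sum_congr rfl fun q hq => ?_
    have := Finset.mem_range.mp hq
    rw [show m - 1 - (m - 1 - q) = q by omega, swap]
  rw [e2, neg_eq_iff_add_eq_zero, ← two_smul ℂ] at e
  exact (smul_eq_zero_iff_right two_ne_zero).mp e

/-- Complete symmetric functions of `-𝐀_r` move the top particle of a charged vacuum. -/
theorem subA_h_ket (m : ℕ) (N : ℤ) :
    subA r (h m) (ket (N + 1)) = str r N m • ket N := by
  induction m using Nat.strong_induction_on generalizing N with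
  | _ m ih =>
    rcases m with _ | m
    · rw [h_zero, map_one, Module.End.one_apply, str_zero, ψ_smul_ket_self]
    -- The defect of the claim at level `N + 1` is `ψ_{N+1}` times the defect at level `N`. In the
    -- expansion of `h_{m+1} ψ_{N+1}|N+1⟩` the middle terms are known by induction and collapse by
    -- antisymmetry to `-ψ_{N+1} str_{m+1}|N⟩`.
    have step : ∀ N : ℤ, subA r (h (m + 1)) (ket (N + 1 + 1)) - str r (N + 1) (m + 1) • ket (N + 1)
        = ψ (N + 1) • (subA r (h (m + 1)) (ket (N + 1)) - str r N (m + 1) • ket N) := fun N => by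
      have e1 : ∑ q ∈ Finset.range m, str r (N + 1) (0 + (q + 1)) •
          subA r (h (m + 1 - (q + 1))) (ket (N + 1)) =
          ∑ q ∈ Finset.range m, str r (N + 1) (q + 1) • str r N (m + 1 - (q + 1)) • ket N :=
        Finset.sum_congr rfl fun q hq => by rw [ih _ (by omega), zero_add]
      have e2 := sum_str_smul_str_smul r (m + 1) (N + 1) (ket N)
      have e3 : r (N + 1) • ∑ q ∈ Finset.range (m + 1),
          str r (N + 1) q • str r (N + 1) (m + 1 - 1 - q) • ket N =
          ∑ q ∈ Finset.range (m + 1), str r (N + 1) q • str r N (m + 1 - q) • ket N := by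
        rw [Finset.smul_sum]
        refine Finset.sum_congr rfl fun q hq => ?_
        have := Finset.mem_range.mp hq
        rw [show m + 1 - q = (m + 1 - 1 - q) + 1 by omega, str_succ, smul_assoc,
          smul_comm (r (N + 1))]
      rw [e2, smul_zero, Finset.sum_range_succ', str_zero] at e3
      rw [← ψ_smul_ket_self (N + 1), ← str_zero r (N + 1), subA_h_str_smul,
        Finset.sum_range_succ', Finset.sum_range_succ, e1, Nat.sub_self, h_zero, map_one,
        Module.End.one_apply, zero_add, smul_sub, str_zero, Nat.sub_zero]
      rw [Nat.sub_zero] at e3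
      rw [eq_neg_of_add_eq_zero_left e3.symm]
      abel
    have iter : ∀ l : ℕ, ∀ N : ℤ, subA r (h (m + 1)) (ket (N + l + 1)) -
        str r (N + l) (m + 1) • ket (N + l) = raise (N + 1) l •
          (subA r (h (m + 1)) (ket (N + 1)) - str r N (m + 1) • ket N) := by
      intro l
      induction l with
      | zero => intro N; simp [raise]
      | succ l ihl =>
        intro N
        rw [raise, mul_smul, ← ihl, show N + 1 + l = N + l + 1 by ring, ← step]
        push_cast
        rw [← add_assoc]
    -- Going down `m + 1` levels suffices: the defect there lies in a window of width `m + 1`, which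
    -- the `m + 1` raising fermions annihilate.
    have fin := iter (m + 1) (N - (m + 1 : ℕ))
    rw [sub_add_cancel, raise_smul_of_mem le_rfl, sub_eq_zero] at fin
    · exact fin
    · refine sub_mem (subA_h_ket_mem r m _) ?_
      rw [str, smul_assoc]
      refine Submodule.smul_mem _ _ (ψ_smul_mem_upperSpan ?_ ?_ _)
      · push_cast; omega
      · push_cast; omega

/-- Schur functions of `-𝐀_r` acting on a charged vacuum. -/
theorem subA_det_ket {l : ℕ} (a : Fin l → ℕ) (n : ℤ) :
    subA r (Matrix.det (Matrix.of fun i j : Fin l => hInt ((a i : ℤ) - (i : ℤ) + j))) (ket n) =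
      (List.ofFn fun i : Fin l => str r (n - 1 - i) (a i)).prod • ket (n - l) := by
  induction l generalizing n with
  | zero => simp
  | succ l ih =>
    have ih' := ih (fun i => a i.succ) (n - 1)
    -- This map restores the top Jacobi-Trudi row.
    let φ : Polynomial Sym →ₗ[Sym] Sym :=
      (Polynomial.basisMonomials Sym).constr Sym fun k => hInt ((a 0 : ℤ) + k)
    have hφ : ∀ k c, φ (Polynomial.monomial k c) = c * hInt ((a 0 : ℤ) + k) := fun k c => by
      rw [← mul_one c, ← smul_eq_mul, ← Polynomial.smul_monomial, map_smul]
      have := (Polynomial.basisMonomials Sym).constr_basis Sym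
        (fun k => hInt ((a 0 : ℤ) + k)) k
      rw [Polynomial.coe_basisMonomials] at this
      rw [this]
      simp
    -- On vacua the formal power `t^k` may be read in two ways, as the string of length `a_0 + k`
    -- over `|n-1⟩` or as `h_{a_0+k}` acting on `|n⟩`; `subA_h_ket` identifies them.
    have hφ' : ∀ q : Polynomial Sym, stringEval r (fun k => str r (n - 1) (a 0 + k) • ket (n - 1)) q
        = subA r (φ q) (ket n) := fun q => by
      induction q using Polynomial.induction_on' with
      | add p q hp hq => rw [map_add, hp, hq, map_add, map_add, LinearMap.add_apply]
      | monomial k c =>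
        rw [stringEval_monomial, hφ, map_mul, Module.End.mul_apply, ← Nat.cast_add, hInt_natCast,
          ← subA_h_ket, sub_add_cancel]
    rw [← det_hInt_succ (fun i => (a i : ℤ)) φ fun k => by
        rw [← Polynomial.monomial_one_right_eq_X_pow, hφ, one_mul],
      ← hφ', ← str_smul_subA, ih', List.ofFn_succ, List.prod_cons, mul_smul]
    simp only [Fin.val_zero, Fin.val_succ, Nat.cast_zero, sub_zero]
    push_cast
    simp only [show ∀ i : ℤ, n - 1 - 1 - i = n - 1 - (i + 1) from fun i => by ring,
      show n - 1 - (l : ℤ) = n - (l + 1) by ring]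

/-! ### Wedges of fermions and the vectors labelled by partitions. -/

/-- `ψ_{b_1} ψ_{b_2} ⋯ ψ_{b_l}`. -/
def wedge (b : List ℤ) : A := (b.map ψ).prod

theorem prod_ofFn_str {l : ℕ} (j : Fin l → ℤ) (a : Fin l → ℕ) :
    (List.ofFn fun i => str r (j i) (a i)).prod =
      (∏ i, ∏ s ∈ Finset.range (a i), r (j i + 1 + s)) •
        wedge (List.ofFn fun i => j i + a i) := by
  induction l with
  | zero => simp [wedge]
  | succ l ih =>
    rw [List.ofFn_succ, List.prod_cons, ih, Fin.prod_univ_succ, List.ofFn_succ, wedge, wedge,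
      List.map_cons, List.prod_cons, str, smul_mul_smul_comm]

theorem rProd_eq (lam : YoungDiagram) (n : ℤ) : rProd r lam n =
    ∏ i : Fin (lam.colLen 0), ∏ s ∈ Finset.range (lam.rowLen i), r (n - 1 - i + 1 + s) := by
  rw [rProd, Fin.prod_univ_eq_prod_range
    (fun i => ∏ s ∈ Finset.range (lam.rowLen i), r (n - 1 - i + 1 + s)), Finset.prod_sigma']
  refine Finset.prod_bij' (fun c _ => ⟨c.1, c.2⟩) (fun c _ => (c.1, c.2)) ?_ ?_ ?_ ?_ ?_
  · rintro ⟨i, j⟩ hc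
    rw [YoungDiagram.mem_cells] at hc
    have h0 : (i, 0) ∈ lam := lam.up_left_mem le_rfl (Nat.zero_le j) hc
    simpa using ⟨YoungDiagram.mem_iff_lt_colLen.mp h0, YoungDiagram.mem_iff_lt_rowLen.mp hc⟩
  · rintro ⟨i, j⟩ hc
    simp only [Finset.mem_sigma, Finset.mem_range] at hc
    exact (YoungDiagram.mem_cells _).mpr (YoungDiagram.mem_iff_lt_rowLen.mpr hc.2)
  · simp
  · simp
  · rintro ⟨i, j⟩ _
    dsimp only
    ring_nf

/-- The first `l` momenta of the basis vector labelled by `lam` in charge `n`. -/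
def maya (lam : YoungDiagram) (n : ℤ) (l : ℕ) : List ℤ :=
  List.ofFn fun i : Fin l => n - 1 - i + lam.rowLen i

/-- The basis vector of the Fock space of charge `n` labelled by `lam`. -/
def basisKet (lam : YoungDiagram) (n : ℤ) : Fock :=
  wedge (maya lam n (lam.colLen 0)) • ket (n - lam.colLen 0)

theorem subA_schur_ket (lam : YoungDiagram) (n : ℤ) :
    subA r (schur lam) (ket n) = rProd r lam n • basisKet lam n := by
  rw [schur, subA_det_ket r (fun i => lam.rowLen i), prod_ofFn_str, ← rProd_eq, smul_assoc]
  rfl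

end subA

/-! ### The contravariant form on the Fock space -/

/-- The isometry exchanging `ψ_m` and `ψ*_m`. -/
def swapIsometry : Q →qᵢ Q where
  toLinearMap := (LinearMap.snd ℂ (ℤ →₀ ℂ) (ℤ →₀ ℂ)).prod (LinearMap.fst ℂ (ℤ →₀ ℂ) (ℤ →₀ ℂ))
  map_app' w := wpair_symm _ w.2 w.1

theorem swapIsometry_apply (w : W) : swapIsometry w = (w.2, w.1) := rfl

/-- The anti-automorphism exchanging `ψ_m` and `ψ*_m`. -/
def dagger : A →ₗ[ℂ] A :=
  CliffordAlgebra.reverse ∘ₗ (CliffordAlgebra.map swapIsometry).toLinearMap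

theorem dagger_one : dagger 1 = 1 := by simp [dagger]

theorem dagger_mul (a b : A) : dagger (a * b) = dagger b * dagger a := by simp [dagger]

theorem dagger_ψ (m : ℤ) : dagger (ψ m) = ψs m := by
  simp [dagger, ψ, ψs, swapIsometry_apply]

theorem dagger_ψs (m : ℤ) : dagger (ψs m) = ψ m := by
  simp [dagger, ψ, ψs, swapIsometry_apply]

theorem bra0_ψ_smul {m : ℤ} (hm : 0 ≤ m) (v : Fock) : bra0 (ψ m • v) = 0 := by
  obtain ⟨a, rfl⟩ := exists_smul_vac v
  rw [smul_smul, bra0_smul_vac]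
  refine vev_ι_mul_eq_zero (LinearMap.ext fun w => ?_) a
  rw [twoPoint_apply]
  simp [wpair, not_lt.mpr hm]

theorem bra0_ψs_smul {m : ℤ} (hm : m < 0) (v : Fock) : bra0 (ψs m • v) = 0 := by
  obtain ⟨a, rfl⟩ := exists_smul_vac v
  rw [smul_smul, bra0_smul_vac]
  refine vev_ι_mul_eq_zero (LinearMap.ext fun w => ?_) a
  rw [twoPoint_apply]
  simp [wpair, hm]

/-- This makes the contravariant form well defined on the quotient: `dagger` carries the
annihilators of `|0⟩` to those of `⟨0|`. -/
theorem bra0_dagger_smul_eq_zero {a : A} (ha : a ∈ annIdeal) (v : Fock) :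
    bra0 (dagger a • v) = 0 := by
  induction ha using Submodule.span_induction generalizing v with
  | mem x hx =>
    rcases hx with ⟨m, hm, rfl⟩ | ⟨m, hm, rfl⟩
    · rw [dagger_ψ, bra0_ψs_smul hm]
    · rw [dagger_ψs, bra0_ψ_smul hm]
  | zero => simp
  | add x y _ _ hx hy => rw [map_add, add_smul, map_add, hx, hy, add_zero]
  | smul c x _ hx => rw [smul_eq_mul, dagger_mul, mul_smul, hx]

/-- The bilinear form on the Fock space with `(ψ_m u, v) = (u, ψ*_m v)` and `(|0⟩, |0⟩) = 1`. -/
def form : Fock →ₗ[ℂ] Fock →ₗ[ℂ] ℂ :=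
  Submodule.liftQ (annIdeal.restrictScalars ℂ)
    (LinearMap.llcomp ℂ Fock Fock ℂ bra0 ∘ₗ (Algebra.lsmul ℂ ℂ Fock).toLinearMap ∘ₗ dagger)
    fun _ ha => LinearMap.ext fun v => bra0_dagger_smul_eq_zero ha v

theorem form_smul_vac (a : A) (v : Fock) : form (a • vac) v = bra0 (dagger a • v) := by
  rw [← mk_eq_smul_vac]
  rfl

theorem form_vac (v : Fock) : form vac v = bra0 v := by
  have := form_smul_vac 1 v
  rwa [one_smul, dagger_one, one_smul] at this

theorem form_ψ_smul (m : ℤ) (u v : Fock) : form (ψ m • u) v = form u (ψs m • v) := by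
  obtain ⟨a, rfl⟩ := exists_smul_vac u
  rw [smul_smul, form_smul_vac, form_smul_vac, dagger_mul, dagger_ψ, mul_smul]

theorem form_ψs_smul (m : ℤ) (u v : Fock) : form (ψs m • u) v = form u (ψ m • v) := by
  obtain ⟨a, rfl⟩ := exists_smul_vac u
  rw [smul_smul, form_smul_vac, form_smul_vac, dagger_mul, dagger_ψs, mul_smul]

theorem dagger_raiseKet (N : ℕ) : dagger (raiseKet N) = raiseBra N := by
  induction N with
  | zero => exact dagger_one
  | succ N ih => rw [raiseKet, dagger_mul, ih, dagger_ψ, raiseBra]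

theorem dagger_lowerKet (N : ℕ) : dagger (lowerKet N) = lowerBra N := by
  induction N with
  | zero => exact dagger_one
  | succ N ih => rw [lowerKet, dagger_mul, ih, dagger_ψs, lowerBra]

theorem form_ket (n : ℤ) (v : Fock) : form (ket n) v = bra n v := by
  rw [ket, bra]
  split_ifs
  · rw [form_smul_vac, dagger_raiseKet]; rfl
  · rw [form_smul_vac, dagger_lowerKet]; rfl

theorem form_ket_ket (n : ℤ) : form (ket n) (ket n) = 1 := by
  have step : ∀ n : ℤ, form (ket (n + 1)) (ket (n + 1)) = form (ket n) (ket n) := fun n => by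
    rw [← ψ_smul_ket_self, form_ψ_smul, ψs_smul_ψ_self, ψs_smul_ket le_rfl, smul_zero, sub_zero]
  induction n using Int.induction_on with
  | zero =>
    have := bra0_smul_vac 1
    rwa [one_smul, vev_one, ← form_vac, ← ket_zero] at this
  | succ n ih => rw [step, ih]
  | pred n ih => rw [← step, sub_add_cancel, ih]

theorem form_mode (c : ℤ → ℂ) {k : ℤ} (hk : k ≠ 0) (u v : Fock) :
    form (mode c k hk u) v = form u (mode (fun i => c (i - k)) (-k) (neg_ne_zero.mpr hk) v) := by
  have e1 : form (mode c k hk u) v = ∑ᶠ i, c i * form u (ψ (i + k) • ψs i • v) := by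
    rw [mode_apply, ← LinearMap.flip_apply, map_finsum _ (finite_mode c hk u)]
    refine finsum_congr fun i => ?_
    rw [LinearMap.flip_apply, smul_assoc, map_smul, LinearMap.smul_apply, mul_smul, form_ψ_smul,
      form_ψs_smul, smul_eq_mul]
  rw [e1, mode_apply, map_finsum _ (finite_mode _ (neg_ne_zero.mpr hk) v)]
  refine finsum_eq_of_bijective (· + k) (Equiv.addRight k).bijective fun i => ?_
  rw [smul_assoc, mul_smul, map_smul (form u) (c _), smul_eq_mul, add_sub_cancel_right,
    add_neg_cancel_right]

theorem form_Hvec (m : ℕ+) (u v : Fock) : form u (Hvec m v) = form (HstarVec m u) v := by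
  rw [Hvec_eq_mode, HstarVec, H_eq_mode, LinearMap.smul_apply, LinearMap.smul_apply, map_smul,
    map_smul, LinearMap.smul_apply, form_mode]
  simp only [neg_neg]

/-! ### Orthonormality of the basis vectors -/

theorem ψs_smul_wedge_smul {x N : ℤ} {b : List ℤ} (hx : N ≤ x) (hb : x ∉ b) :
    ψs x • wedge b • ket N = 0 := by
  induction b with
  | nil => simp [wedge, ψs_smul_ket hx]
  | cons y b ih =>
    simp only [List.mem_cons, not_or] at hb
    rw [wedge, List.map_cons, List.prod_cons, mul_smul, ψs_smul_ψ_of_ne hb.1]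
    rw [← wedge, ih hb.2, smul_zero, neg_zero]

theorem wedge_cons_smul (x : ℤ) (b : List ℤ) (v : Fock) :
    wedge (x :: b) • v = ψ x • wedge b • v := by
  rw [wedge, List.map_cons, List.prod_cons, mul_smul, wedge]

/-- The leading momenta are compared. If they differ, the larger one, moved to the other side as
`ψ*`, meets no partner and annihilates; if they agree, they cancel. -/
theorem form_wedge {N : ℤ} {a b : List ℤ} (hl : a.length = b.length)
    (ha : a.Pairwise (· > ·)) (hb : b.Pairwise (· > ·)) (haN : ∀ x ∈ a, N ≤ x)
    (hbN : ∀ x ∈ b, N ≤ x) :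
    form (wedge a • ket N) (wedge b • ket N) = if a = b then 1 else 0 := by
  induction a generalizing b with
  | nil =>
    obtain rfl := List.eq_nil_of_length_eq_zero hl.symm
    simp [wedge, form_ket_ket]
  | cons x a ih =>
    rcases b with _ | ⟨y, b⟩
    · simp at hl
    have ha' := List.pairwise_cons.mp ha
    have hb' := List.pairwise_cons.mp hb
    rcases lt_trichotomy x y with hxy | rfl | hxy
    · have hy : y ∉ x :: a := by
        rw [List.mem_cons, not_or]
        exact ⟨hxy.ne', fun hm => by have := ha'.1 y hm; omega⟩
      rw [if_neg (by simp [hxy.ne]), wedge_cons_smul y, ← form_ψs_smul,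
        ψs_smul_wedge_smul (hbN y (by simp)) hy, map_zero, LinearMap.zero_apply]
    · have hx : x ∉ b := fun hm => by have := hb'.1 x hm; omega
      rw [wedge_cons_smul, wedge_cons_smul, form_ψ_smul, ψs_smul_ψ_self,
        ψs_smul_wedge_smul (hbN x (by simp)) hx, smul_zero, sub_zero,
        ih (by simpa using hl) ha'.2 hb'.2 (fun z hz => haN z (by simp [hz]))
          (fun z hz => hbN z (by simp [hz]))]
      simp
    · have hx : x ∉ y :: b := by
        rw [List.mem_cons, not_or]
        exact ⟨hxy.ne', fun hm => by have := hb'.1 x hm; omega⟩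
      rw [if_neg (by simp [hxy.ne']), wedge_cons_smul x, form_ψ_smul,
        ψs_smul_wedge_smul (haN x (by simp)) hx, map_zero]

theorem rowLen_eq_zero {lam : YoungDiagram} {i : ℕ} (hi : lam.colLen 0 ≤ i) :
    lam.rowLen i = 0 := by
  by_contra hne
  have := YoungDiagram.mem_iff_lt_colLen.mp
    (YoungDiagram.mem_iff_lt_rowLen.mpr (Nat.pos_of_ne_zero hne))
  omega

/-- Rows of length zero may be added freely: such a row contributes the fermion that raises
`|n-l-1⟩` to `|n-l⟩`. Thus two partitions can be compared over a common lower vacuum. -/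
theorem wedge_maya_smul_ket {lam : YoungDiagram} (n : ℤ) {l : ℕ} (hl : lam.colLen 0 ≤ l) :
    wedge (maya lam n l) • ket (n - l) = basisKet lam n := by
  induction l, hl using Nat.le_induction with
  | base => rfl
  | succ l hl ih =>
    rw [← ih, maya, List.ofFn_succ', List.concat_eq_append, wedge, List.map_append,
      List.prod_append, mul_smul]
    simp only [Fin.val_last, rowLen_eq_zero hl, List.map_cons, List.map_nil, List.prod_singleton,
      Fin.val_castSucc]
    rw [show n - 1 - (l : ℤ) + (0 : ℕ) = n - l - 1 by push_cast; ring,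
      show n - ((l + 1 : ℕ) : ℤ) = n - l - 1 by push_cast; ring, ψ_smul_ket_pred]
    rfl

theorem maya_pairwise (lam : YoungDiagram) (n : ℤ) (l : ℕ) :
    (maya lam n l).Pairwise (· > ·) := by
  rw [maya, List.pairwise_ofFn]
  intro i j hij
  have := lam.rowLen_anti i j hij.le
  have : (i : ℕ) < j := hij
  omega

theorem le_of_mem_maya {lam : YoungDiagram} {n : ℤ} {l : ℕ} {x : ℤ} (hx : x ∈ maya lam n l) :
    n - l ≤ x := by
  rw [maya, List.mem_ofFn] at hx
  obtain ⟨i, rfl⟩ := hx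
  omega

theorem maya_inj {lam mu : YoungDiagram} {n : ℤ} {l : ℕ} (h1 : lam.colLen 0 ≤ l)
    (h2 : mu.colLen 0 ≤ l) : maya lam n l = maya mu n l ↔ lam = mu := by
  refine ⟨fun e => ?_, fun e => by rw [e]⟩
  have e' := List.ofFn_injective e
  have row : ∀ i, lam.rowLen i = mu.rowLen i := fun i => by
    rcases lt_or_ge i l with hi | hi
    · simpa using congrFun e' ⟨i, hi⟩
    · rw [rowLen_eq_zero (h1.trans hi), rowLen_eq_zero (h2.trans hi)]
  ext ⟨i, j⟩
  rw [YoungDiagram.mem_cells, YoungDiagram.mem_cells, YoungDiagram.mem_iff_lt_rowLen,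
    YoungDiagram.mem_iff_lt_rowLen, row]

open Classical in
theorem form_basisKet (mu lam : YoungDiagram) (n : ℤ) :
    form (basisKet mu n) (basisKet lam n) = if mu = lam then 1 else 0 := by
  have h1 := le_max_left (mu.colLen 0) (lam.colLen 0)
  have h2 := le_max_right (mu.colLen 0) (lam.colLen 0)
  rw [← wedge_maya_smul_ket n h1, ← wedge_maya_smul_ket n h2,
    form_wedge (by simp [maya]) (maya_pairwise _ _ _) (maya_pairwise _ _ _)
      (fun _ => le_of_mem_maya) (fun _ => le_of_mem_maya)]
  simp only [maya_inj h1 h2]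

/-! ### The scalar products as expectation values -/

theorem evalOps_HstarVec (f : Sym) : evalOps HstarVec f = subA (fun _ => 1) f := by
  rw [show HstarVec = fun m => -Avec (fun _ => 1) m from funext HstarVec_eq_neg_Avec,
    evalOps_eq_evalHom (commute_neg_Avec _), subA]

theorem evalOps_neg_Avec (r : ℤ → ℂ) (f : Sym) : evalOps (fun m => -Avec r m) f = subA r f := by
  rw [evalOps_eq_evalHom (commute_neg_Avec _), subA]

/-- Taking adjoints reverses products, which is harmless because the substituted modes commute. -/
theorem form_evalOps_Hvec (f : Sym) (u v : Fock) :
    form u (evalOps Hvec f v) = form (subA (fun _ => 1) f u) v := by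
  rw [evalOps_eq_evalHom commute_Hvec]
  induction f using MvPolynomial.induction_on generalizing v with
  | C a => rw [evalHom_C, subA, evalHom_C]; simp
  | add f g hf hg => simp only [map_add, LinearMap.add_apply, hf, hg]
  | mul_X f m hf =>
    rw [map_mul, Module.End.mul_apply, hf, evalHom_X, form_Hvec, mul_comm, map_mul,
      Module.End.mul_apply, subA_X, HstarVec_eq_neg_Avec]

theorem bra_evalOps (r : ℤ → ℂ) (n : ℤ) (f g : Sym) :
    bra n (evalOps Hvec f (evalOps (fun m => -Avec r m) g (ket n))) =
      form (subA (fun _ => 1) f (ket n)) (subA r g (ket n)) := by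
  rw [← form_ket, form_evalOps_Hvec, evalOps_neg_Avec]

theorem rProd_one (lam : YoungDiagram) (n : ℤ) : rProd (fun _ => 1) lam n = 1 :=
  Finset.prod_const_one

theorem subA_one_schur_ket (lam : YoungDiagram) (n : ℤ) :
    subA (fun _ => 1) (schur lam) (ket n) = basisKet lam n := by
  rw [subA_schur_ket, rProd_one, one_smul]

open Classical in
theorem form_schur (r : ℤ → ℂ) (n : ℤ) (mu lam : YoungDiagram) :
    form (subA (fun _ => 1) (schur mu) (ket n)) (subA r (schur lam) (ket n)) =
      if mu = lam then rProd r lam n else 0 := by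
  rw [subA_one_schur_ket, subA_schur_ket, map_smul, form_basisKet]
  split_ifs <;> simp

/-! ### Positive Heisenberg modes as derivatives. -/

theorem commute_derivVec (j k : ℕ+) : Commute (derivVec j) (derivVec k) := by
  have : ⁅MvPolynomial.pderiv (R := ℂ) j, MvPolynomial.pderiv (R := ℂ) k⁆ = 0 := by
    refine MvPolynomial.derivation_ext fun i => ?_
    rw [Derivation.commutator_apply]
    simp [MvPolynomial.pderiv_X, Pi.single_apply, apply_ite]
  have comm : Commute (MvPolynomial.pderiv j : Derivation ℂ Sym Sym).toLinearMap
      (MvPolynomial.pderiv k : Derivation ℂ Sym Sym).toLinearMap := by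
    refine LinearMap.ext fun f => ?_
    have := congrArg (fun D : Derivation ℂ Sym Sym => D f) this
    rw [Derivation.commutator_apply] at this
    exact sub_eq_zero.mp this
  exact (comm.smul_left _).smul_right _

theorem Hvec_HstarVec (j k : ℕ+) (v : Fock) : Hvec j (HstarVec k v) =
    HstarVec k (Hvec j v) + (if j = k then (j : ℂ)⁻¹ else 0) • v := by
  have e := LinearMap.congr_fun (H_mul_H_neg j k) v
  rw [LinearMap.sub_apply, Module.End.mul_apply, Module.End.mul_apply, sub_eq_iff_eq_add'] at e
  simp only [Hvec, HstarVec, LinearMap.smul_apply, map_smul, e, smul_add, Module.End.one_apply]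
  rw [smul_comm]
  congr 1
  split_ifs with hjk
  · subst hjk
    simp [smul_smul]
  · simp

/-- The commutator with `H_j/j` is a derivation, and by the Heisenberg relation it agrees with
`∂_j/j` on the generators. -/
theorem Hvec_subA (j : ℕ+) (g : Sym) (v : Fock) : Hvec j (subA (fun _ => 1) g v) =
    subA (fun _ => 1) g (Hvec j v) + subA (fun _ => 1) (derivVec j g) v := by
  induction g using MvPolynomial.induction_on generalizing v with
  | C a => rw [subA, evalHom_C]; simp [derivVec]
  | add f g hf hg =>
    simp only [map_add, LinearMap.add_apply, hf, hg]
    abel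
  | mul_X f m hf =>
    have hd : derivVec j (f * MvPolynomial.X m) = derivVec j f * MvPolynomial.X m +
        (if j = m then (j : ℂ)⁻¹ else 0) • f := by
      simp only [derivVec, LinearMap.smul_apply, Derivation.coeFn_coe, Derivation.leibniz,
        MvPolynomial.pderiv_X, Pi.single_apply, smul_eq_mul]
      rcases eq_or_ne j m with rfl | hne
      · simp [mul_comm, add_comm]
      · simp [hne, hne.symm, mul_comm]
    rw [hd, map_add, map_mul, map_mul, map_smul]
    simp only [Module.End.mul_apply, LinearMap.add_apply, LinearMap.smul_apply, subA_X]
    rw [hf, ← HstarVec_eq_neg_Avec, Hvec_HstarVec, map_add, map_smul]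
    abel

theorem Hvec_subA_vac (j : ℕ+) (g : Sym) :
    Hvec j (subA (fun _ => 1) g vac) = subA (fun _ => 1) (derivVec j g) vac := by
  rw [Hvec_subA, ← ket_zero, Hvec_eq_mode, LinearMap.smul_apply, mode_ket _ (by simp), smul_zero,
    map_zero, zero_add]

theorem evalOps_Hvec_subA_vac (f g : Sym) : evalOps Hvec f (subA (fun _ => 1) g vac) =
    subA (fun _ => 1) (evalOps derivVec f g) vac := by
  rw [evalOps_eq_evalHom commute_Hvec, evalOps_eq_evalHom commute_derivVec]
  induction f using MvPolynomial.induction_on generalizing g with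
  | C a => simp
  | add f f' hf hf' => simp only [map_add, LinearMap.add_apply, hf, hf']
  | mul_X f m hf =>
    rw [map_mul, map_mul, Module.End.mul_apply, Module.End.mul_apply, evalHom_X, evalHom_X,
      Hvec_subA_vac, hf]

theorem bra0_HstarVec (m : ℕ+) (v : Fock) : bra0 (HstarVec m v) = 0 := by
  rw [← form_vac, HstarVec, H_eq_mode, LinearMap.smul_apply, map_smul]
  have := form_mode (fun _ => 1) (show (m : ℤ) ≠ 0 by simp) vac v
  rw [← ket_zero, mode_ket _ (by simp), map_zero, LinearMap.zero_apply, ket_zero] at this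
  rw [← this, smul_zero]

theorem bra0_subA_vac (g : Sym) :
    bra0 (subA (fun _ => 1) g vac) = MvPolynomial.constantCoeff g := by
  induction g using MvPolynomial.induction_on with
  | C a =>
    have := bra0_smul_vac 1
    rw [one_smul, vev_one] at this
    rw [subA, evalHom_C]
    simp [this]
  | add f g hf hg => simp only [map_add, LinearMap.add_apply, hf, hg]
  | mul_X f m hf =>
    rw [mul_comm, map_mul, Module.End.mul_apply, subA_X, ← HstarVec_eq_neg_Avec, bra0_HstarVec]
    simp

theorem scalarProduct_eq (f g : Sym) : scalarProduct f g =
    bra 0 (evalOps Hvec f (evalOps HstarVec g (ket 0))) := by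
  rw [evalOps_HstarVec, ket_zero, evalOps_Hvec_subA_vac, ← form_ket, ket_zero, form_vac,
    bra0_subA_vac, scalarProduct]

/-! ### The Schur functions span -/

/-- The kernel of `g ↦ g(H*)|0⟩` is stable under derivatives, since these are realised by `H_j/j`,
and its elements have zero constant term. Differentiating down to the constant term reaches every
coefficient. -/
theorem coeff_eq_zero_of_subA_vac (m : ℕ+ →₀ ℕ) (g : Sym)
    (hg : subA (fun _ => 1) g vac = 0) : g.coeff m = 0 := by
  induction hd : m.degree generalizing m g with
  | zero =>
    rw [Finsupp.degree_eq_zero_iff] at hd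
    rw [hd, ← MvPolynomial.constantCoeff_eq, ← bra0_subA_vac, hg, map_zero]
  | succ d ih =>
    have hm : m ≠ 0 := by rintro rfl; simp at hd
    obtain ⟨i, hi⟩ := Finsupp.ne_iff.mp hm
    have hle : Finsupp.single i 1 ≤ m := by
      rw [Finsupp.single_le_iff]
      exact Nat.one_le_iff_ne_zero.mpr hi
    have hsub := tsub_add_cancel_of_le hle
    have e := ih (m - Finsupp.single i 1) (derivVec i g)
      (by rw [← Hvec_subA_vac, hg, map_zero]) (by
        have := congrArg Finsupp.degree hsub
        rw [map_add, Finsupp.degree_single] at this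
        omega)
    rw [derivVec, LinearMap.smul_apply, MvPolynomial.coeff_smul, smul_eq_zero, Derivation.coeFn_coe,
      MvPolynomial.coeff_pderiv, hsub, mul_eq_zero] at e
    rcases e with e | e | e
    · simp at e
    · exact e
    · exact absurd e (Nat.cast_add_one_ne_zero _)

theorem subA_vac_injective {f g : Sym}
    (hfg : subA (fun _ => 1) f vac = subA (fun _ => 1) g vac) : f = g := by
  rw [← sub_eq_zero]
  ext m
  exact coeff_eq_zero_of_subA_vac m _ (by rw [map_sub, LinearMap.sub_apply, hfg, sub_self])

theorem exists_wedge_eq_smul_of_perm {b b' : List ℤ} (hp : b.Perm b') :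
    ∃ c : ℂ, wedge b = c • wedge b' := by
  induction hp with
  | nil => exact ⟨1, (one_smul _ _).symm⟩
  | cons x _ ih =>
    obtain ⟨c, hc⟩ := ih
    refine ⟨c, ?_⟩
    rw [wedge, wedge, List.map_cons, List.map_cons, List.prod_cons, List.prod_cons, ← wedge,
      ← wedge, hc, mul_smul_comm]
  | swap x y l =>
    refine ⟨-1, ?_⟩
    simp only [wedge, List.map_cons, List.prod_cons, neg_smul, one_smul]
    rw [← mul_assoc, ψ_mul_swap, neg_mul, mul_assoc]
  | trans _ _ ih1 ih2 =>
    obtain ⟨c, hc⟩ := ih1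
    obtain ⟨d, hd⟩ := ih2
    exact ⟨c * d, by rw [hc, hd, smul_smul]⟩

theorem wedge_append (b c : List ℤ) : wedge (b ++ c) = wedge b * wedge c := by
  simp [wedge]

/-- A permutation, at the cost of a scalar, brings the two equal fermions together at the front. -/
theorem wedge_eq_zero_of_not_nodup {b : List ℤ} (hb : ¬b.Nodup) : wedge b = 0 := by
  rw [List.nodup_iff_sublist] at hb
  push Not at hb
  obtain ⟨x, hx⟩ := hb
  obtain ⟨t, ht⟩ := hx.exists_perm_append
  obtain ⟨c, hc⟩ := exists_wedge_eq_smul_of_perm ht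
  rw [hc, wedge_append]
  simp [wedge, ψ_mul_self]

theorem wedge_smul_ket_of_mem_lt {b : List ℤ} {x n : ℤ} (hx : x ∈ b) (hn : x < n) :
    wedge b • ket n = 0 := by
  obtain ⟨c, hc⟩ := exists_wedge_eq_smul_of_perm
    ((List.perm_cons_erase hx).trans (List.perm_append_singleton x (b.erase x)).symm)
  rw [hc, wedge_append, smul_assoc, mul_smul]
  simp [wedge, ψ_smul_ket hn]

theorem getElem_add_le {b : List ℤ} (hb : b.Pairwise (· > ·)) (i d : ℕ) (hd : i + d < b.length) :
    b[i + d] + d ≤ b[i] := by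
  induction d with
  | zero => simp
  | succ d ih =>
    have h1 := ih (by omega)
    have h2 := List.pairwise_iff_getElem.mp hb (i + d) (i + (d + 1)) (by omega) hd (by omega)
    push_cast
    omega

/-- A strictly decreasing list bounded below is the list of momenta of a Young diagram. -/
theorem exists_maya_eq {b : List ℤ} (hb : b.Pairwise (· > ·)) (n : ℤ)
    (hn : ∀ x ∈ b, n - b.length ≤ x) :
    ∃ lam : YoungDiagram, lam.colLen 0 ≤ b.length ∧ maya lam n b.length = b := by
  -- The candidate row length `b_i + i + 1 - n` is nonnegative because `b` drops by at least one per
  -- step and its last entry is at least `n - b.length`.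
  have pos : ∀ (i : ℕ) (hi : i < b.length), 0 ≤ b[i] + i + 1 - n := fun i hi => by
    have h1 := getElem_add_le hb i (b.length - 1 - i) (by omega)
    have h2 := hn _ (List.getElem_mem (l := b) (n := i + (b.length - 1 - i)) (by omega))
    omega
  set w : List ℕ := List.ofFn fun i : Fin b.length => (b[i] + i + 1 - n).toNat with hw
  have hlen : w.length = b.length := by simp [hw]
  have hsorted : w.SortedGE := by
    refine Antitone.sortedGE_ofFn fun i j hij => ?_
    have h1 := getElem_add_le hb i (j - i) (by omega)
    simp only [Nat.add_sub_cancel' (show (i : ℕ) ≤ j from hij)] at h1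
    have : (i : ℕ) ≤ j := hij
    refine Int.toNat_le_toNat ?_
    simp only [Fin.getElem_fin]
    omega
  -- Some entries of `w` may be zero, so the diagram can have fewer rows than `b` has entries.
  refine ⟨YoungDiagram.ofRowLens w hsorted, ?_, ?_⟩
  · by_contra hlt
    have := YoungDiagram.mem_iff_lt_colLen.mpr (not_le.mp hlt)
    rw [YoungDiagram.mem_ofRowLens] at this
    obtain ⟨h1, -⟩ := this
    simp only [hlen] at h1
    omega
  · refine List.ext_getElem (by simp [maya]) fun i h1 h2 => ?_
    have e : (YoungDiagram.ofRowLens w hsorted).rowLen i = w[i]'(by omega) :=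
      YoungDiagram.rowLen_ofRowLens ⟨i, by omega⟩
    have := pos i h2
    simp only [maya, List.getElem_ofFn, e]
    simp only [hw, List.getElem_ofFn, Fin.getElem_fin]
    omega

theorem wedge_smul_ket_mem (b : List ℤ) (n : ℤ) : wedge b • ket (n - b.length) ∈
    Submodule.span ℂ (Set.range fun lam => basisKet lam n) := by
  by_cases hnd : b.Nodup
  swap
  · rw [wedge_eq_zero_of_not_nodup hnd, zero_smul]
    exact zero_mem _
  by_cases hlt : ∃ x ∈ b, x < n - b.length
  · obtain ⟨x, hx, hx'⟩ := hlt
    rw [wedge_smul_ket_of_mem_lt hx hx']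
    exact zero_mem _
  push Not at hlt
  have hp := List.perm_insertionSort (· ≥ ·) b
  obtain ⟨c, hc⟩ := exists_wedge_eq_smul_of_perm hp.symm
  have hs : (b.insertionSort (· ≥ ·)).Pairwise (· > ·) :=
    (List.pairwise_insertionSort (· ≥ ·) b).imp₂ (fun _ _ h1 h2 => lt_of_le_of_ne h1 h2.symm)
      (hp.nodup_iff.mpr hnd)
  obtain ⟨lam, h1, h2⟩ := exists_maya_eq hs n fun x hx => by
    rw [List.length_insertionSort]
    exact hlt x (hp.mem_iff.mp hx)
  rw [hc, smul_assoc, ← h2, ← List.length_insertionSort (· ≥ ·) b, wedge_maya_smul_ket n h1]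
  exact Submodule.smul_mem _ _ (Submodule.subset_span ⟨lam, rfl⟩)

theorem exists_wedge_eq_raise (N : ℤ) (l : ℕ) :
    ∃ b : List ℤ, b.length = l ∧ wedge b = raise N l := by
  induction l with
  | zero => exact ⟨[], rfl, by simp [wedge, raise]⟩
  | succ l ih =>
    obtain ⟨b, hb, e⟩ := ih
    refine ⟨(N + l) :: b, by simp [hb], ?_⟩
    rw [raise, ← e, wedge, List.map_cons, List.prod_cons, wedge]

/-- The commutator acts as a derivation, replacing one `ψ_x` at a time by a multiple of `ψ_{x-k}`;
the number of fermions stays the same. -/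
theorem mode_wedge_smul_sub_mem (c : ℤ → ℂ) {k : ℤ} (hk : k ≠ 0) (b : List ℤ) (v : Fock) :
    mode c k hk (wedge b • v) - wedge b • mode c k hk v ∈
      Submodule.span ℂ {u | ∃ b' : List ℤ, b'.length = b.length ∧ u = wedge b' • v} := by
  induction b with
  | nil => simp [wedge]
  | cons x b ih =>
    rw [wedge_cons_smul, wedge_cons_smul, mode_ψ_smul, add_sub_right_comm, ← smul_sub]
    refine add_mem ?_ (Submodule.smul_mem _ _ (Submodule.subset_span
      ⟨(x - k) :: b, by simp, by rw [wedge_cons_smul]⟩))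
    generalize mode c k hk (wedge b • v) - wedge b • mode c k hk v = y at ih
    induction ih using Submodule.span_induction with
    | mem u hu =>
      obtain ⟨b', hb', rfl⟩ := hu
      exact Submodule.subset_span ⟨x :: b', by simp [hb'], by rw [wedge_cons_smul]⟩
    | zero => simp
    | add u u' _ _ hu hu' => rw [smul_add]; exact add_mem hu hu'
    | smul a u _ hu => rw [smul_comm]; exact Submodule.smul_mem _ _ hu

theorem mode_basisKet_mem (c : ℤ → ℂ) (k : ℕ) (hk : -(k : ℤ) ≠ 0) (n : ℤ) (lam : YoungDiagram) :
    mode c (-k) hk (basisKet lam n) ∈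
      Submodule.span ℂ (Set.range fun lam => basisKet lam n) := by
  set l := lam.colLen 0 with hl
  -- Writing the vector over a vacuum `k` levels lower makes the direct action of the mode on that
  -- vacuum vanish under the raising factor, so only the commutator contributes.
  obtain ⟨b, hb, e⟩ := exists_wedge_eq_raise (n - l - k) k
  have e2 : basisKet lam n = wedge (maya lam n l ++ b) • ket (n - l - k) := by
    rw [wedge_append, mul_smul, e, raise_smul_ket, sub_add_cancel]
    rfl
  have hlen : (maya lam n l ++ b).length = l + k := by simp [maya, hb]
  have h0 : wedge (maya lam n l ++ b) • mode c (-k) hk (ket (n - l - k)) = 0 := by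
    rw [wedge_append, mul_smul, e, raise_smul_of_mem le_rfl (mode_ket_mem_upperSpan _ _ _ _),
      smul_zero]
  have := mode_wedge_smul_sub_mem c hk (maya lam n l ++ b) (ket (n - l - k))
  rw [h0, sub_zero, ← e2] at this
  refine Submodule.span_le.mpr ?_ this
  rintro _ ⟨b', hb', rfl⟩
  have hmem := wedge_smul_ket_mem b' n
  rw [hb', hlen] at hmem
  rwa [sub_sub, ← Nat.cast_add]

theorem basisKet_bot (n : ℤ) : basisKet ⊥ n = ket n := by
  have : (⊥ : YoungDiagram).colLen 0 ≤ 0 := by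
    by_contra hlt
    exact YoungDiagram.notMem_bot _ (YoungDiagram.mem_iff_lt_colLen.mpr (not_le.mp hlt))
  rw [← wedge_maya_smul_ket n this]
  simp [maya, wedge]

theorem subA_one_ket_mem (f : Sym) (n : ℤ) : subA (fun _ => 1) f (ket n) ∈
    Submodule.span ℂ (Set.range fun lam => basisKet lam n) := by
  induction f using MvPolynomial.induction_on with
  | C a =>
    rw [subA, evalHom_C, LinearMap.smul_apply, Module.End.one_apply, ← basisKet_bot]
    exact Submodule.smul_mem _ _ (Submodule.subset_span ⟨⊥, rfl⟩)
  | add f g hf hg => rw [map_add]; exact add_mem hf hg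
  | mul_X f m hf =>
    rw [mul_comm, map_mul, Module.End.mul_apply, subA_X, neg_Avec_eq_mode, LinearMap.smul_apply]
    refine Submodule.smul_mem _ _ ?_
    refine Submodule.span_induction (fun u hu => ?_) ?_ (fun u v _ _ hu hv => ?_)
      (fun a u _ hu => ?_) hf
    · obtain ⟨lam, rfl⟩ := hu
      exact mode_basisKet_mem _ _ _ _ _
    · rw [map_zero]; exact zero_mem _
    · rw [map_add]; exact add_mem hu hv
    · rw [map_smul]; exact Submodule.smul_mem _ _ hu

/-- The linear map `f ↦ f(-𝐀_r) |n⟩`. -/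
def subAKet (r : ℤ → ℂ) (n : ℤ) : Sym →ₗ[ℂ] Fock :=
  LinearMap.applyₗ (ket n) ∘ₗ (subA r).toLinearMap

theorem subAKet_apply (r : ℤ → ℂ) (n : ℤ) (f : Sym) : subAKet r n f = subA r f (ket n) := rfl

/-- Every `f(H*)|0⟩` is a combination of the vectors `s_λ(H*)|0⟩`, and injectivity of `f ↦ f(H*)|0⟩`
pulls this relation back to symmetric functions. -/
theorem span_schur : Submodule.span ℂ (Set.range schur) = ⊤ := by
  rw [eq_top_iff]
  intro f _
  have hf := subA_one_ket_mem f 0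
  rw [show (fun lam => basisKet lam 0) = subAKet (fun _ => 1) 0 ∘ schur from
    funext fun lam => (subA_one_schur_ket lam 0).symm, Set.range_comp, Submodule.span_image] at hf
  obtain ⟨g, hg, e⟩ := hf
  rw [subAKet_apply, ket_zero] at e
  rwa [← subA_vac_injective e]

/-- The bilinear form `(f, g) ↦ ⟨n| f(𝐇) g(-𝐀_r) |n⟩`. -/
def deformedForm (r : ℤ → ℂ) (n : ℤ) : LinearMap.BilinForm ℂ Sym :=
  form.compl₁₂ (subAKet (fun _ => 1) n) (subAKet r n)

theorem deformedForm_apply (r : ℤ → ℂ) (n : ℤ) (f g : Sym) : deformedForm r n f g =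
    bra n (evalOps Hvec f (evalOps (fun m => -Avec r m) g (ket n))) := by
  rw [bra_evalOps]
  rfl

open Classical in
theorem deformedForm_schur (r : ℤ → ℂ) (n : ℤ) (mu lam : YoungDiagram) :
    deformedForm r n (schur mu) (schur lam) = if mu = lam then rProd r lam n else 0 :=
  form_schur r n mu lam

theorem isDeformedScalarProduct_deformedForm (r : ℤ → ℂ) (n : ℤ) :
    IsDeformedScalarProduct r n (deformedForm r n) :=
  ⟨fun lam => by rw [deformedForm_schur, if_pos rfl],
    fun mu lam hne => by rw [deformedForm_schur, if_neg hne]⟩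

theorem IsDeformedScalarProduct.eq_deformedForm {r : ℤ → ℂ} {n : ℤ}
    {B : LinearMap.BilinForm ℂ Sym} (hB : IsDeformedScalarProduct r n B) :
    B = deformedForm r n := by
  refine LinearMap.ext_on span_schur ?_
  rintro _ ⟨mu, rfl⟩
  refine LinearMap.ext_on span_schur ?_
  rintro _ ⟨lam, rfl⟩
  rw [deformedForm_schur]
  split_ifs with e
  · rw [e, hB.1]
  · exact hB.2 mu lam e

end FreeFermion

end

theorem mainTheorem1 :
    -- the substituted operators commute, so that the substitutions are unambiguous
    (∀ j k : ℕ+, Commute (FreeFermion.Hvec j) (FreeFermion.Hvec k)) ∧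
    (∀ j k : ℕ+, Commute (FreeFermion.HstarVec j) (FreeFermion.HstarVec k)) ∧
    (∀ (r : ℤ → ℂ) (j k : ℕ+), Commute (FreeFermion.Avec r j) (FreeFermion.Avec r k)) ∧
    -- the undeformed scalar product
    (∀ f g : FreeFermion.Sym,
      FreeFermion.scalarProduct f g =
        FreeFermion.bra 0 (FreeFermion.evalOps FreeFermion.Hvec f
          (FreeFermion.evalOps FreeFermion.HstarVec g (FreeFermion.ket 0)))) ∧
    -- the deformed scalar product is well defined and is a vacuum expectation
    (∀ (r : ℤ → ℂ) (n : ℤ),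
      (∃! B : LinearMap.BilinForm ℂ FreeFermion.Sym,
        FreeFermion.IsDeformedScalarProduct r n B) ∧
      ∀ B : LinearMap.BilinForm ℂ FreeFermion.Sym,
        FreeFermion.IsDeformedScalarProduct r n B →
        ∀ f g : FreeFermion.Sym,
          B f g = FreeFermion.bra n (FreeFermion.evalOps FreeFermion.Hvec f
            (FreeFermion.evalOps (fun m => -FreeFermion.Avec r m) g (FreeFermion.ket n)))) := by
  refine ⟨FreeFermion.commute_Hvec, FreeFermion.commute_HstarVec, FreeFermion.commute_Avec,
    FreeFermion.scalarProduct_eq, fun r n => ⟨⟨FreeFermion.deformedForm r n,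
      FreeFermion.isDeformedScalarProduct_deformedForm r n, fun B hB => hB.eq_deformedForm⟩,
      fun B hB f g => ?_⟩⟩
  rw [hB.eq_deformedForm, FreeFermion.deformedForm_apply]
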